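/- Let $G=(V_1;V_2,E)$ be a finite bipartite graph given by adjacency lists (for each node of $V_1$ and each node of $V_2$, a linked list of its neighbours, in arbitrary order). Let $n_1=|V_1|$, $m=|E|$, and let $\kappa$ be the maximum number of edges in a matching of $G$. (It is customary to let $V_1$ be the smaller side; this is not needed.) The matching-pseudoflow algorithm maintains a partition of the nodes into branches of four types: $ST_1$ (a single node of $V_1$), $WT_1$ (a single node of $V_2$), $WT_2$ (a root in $V_2$ with one child in $V_1$ adjacent to it), and $ST_2$ (a root in $V_2$ with two children in $V_1$ adjacent to it). Initially all branches are single nodes. It then works as follows. 1. *Greedy initialization.* For each $v\in V_1$, the list of $v$ is scanned up to the first $WT_1$ neighbour $w$, and if there is one, $v$ and $w$ are joined to a $WT_2$ branch. 2. *Stages (global relabeling, then mergers).* The two-edge distance label of a $WT_1$ branch is $0$. A $WT_2$ branch gets label $1$ if its child has a $WT_1$ neighbour; only branches whose child had label $1$ in the previous stage (in the first stage, all $WT_2$ branches) are tested, and the scan of the list of a child resumes at the arc last scanned. For $p=1,2,\dots$, the incoming arcs of the roots labelled $p$ are scanned, and unlabelled $WT_2$ branches found in this way get label $p+1$, until an $ST_1$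 neighbour is found; then $\ell=p+1$ is the lowest label of an $ST_1$ branch. If no $ST_1$ branch is found in this way, the algorithm stops. Otherwise all nodes are unvisited. For each root $w$ with label $\ell-1$, the incoming arcs of $w$ are scanned as long as $w$ is unvisited, and from each unvisited $ST_1$ neighbour $v$ found (which gets label $\ell$) a search is started; after its search, $v$ is marked as visited. A search from a node of $V_1$ with label $p$ scans its list for an unvisited root of label $p-1$. If $p=1$ and one is found, a $WT_2$ branch is formed, the search has succeeded, and the roots along the path are marked as visited. If $p>1$ and one is found, the merger creates an $ST_2$ branch (the excess leaves the branch that contained the searching node, which becomes a $WT_2$ branch again or was $ST_1$), and the search continues from the old child of that root, which has label $p-1$; if that fails, the merger is reversed, the root is marked as visited, and the scan goes on. Labels are not changed within a stage (delayed relabeling). After all roots with label $\ell-1$ are processed, a new stage begins. The algorithm is executed on a random access machine with unit-cost reads and writes of memory cells and unit-cost steps along linked lists, with loop iterations and procedure calls also charged; memory cells have given constant initial contents, and the input lists are already in memory. Then the algorithm terminates, and the edges of its final $WT_2$ branches form a maximum matching of $G$. Moreover there is an absolute constant $C$ such that, whenever $1\le n_1\le m$ (for example if $V_1$ is non-empty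 and has no isolated nodes), its running time is at most $$C\left(\min\{n_1\kappa,m\}+\sqrt{\kappa}\,\min\{\kappa^2,m\}\right),$$ and for every $G$, without this condition, its running time is at most $$C\left(\min\{n_1\kappa,m\}+\sqrt{\kappa}\,\min\{\kappa^2,m\}+n_1+1\right).$$ -/

import Mathlib

namespace MatchingPseudoflow

/-! ## Bipartite graphs, matchings, adjacency lists -/

/-- The maximum number of edges in a matching of `G`. -/
noncomputable def matchingNumber {V : Type*} (G : SimpleGraph V) : ℕ :=
  sSup {k : ℕ | ∃ M : G.Subgraph, M.IsMatching ∧ M.edgeSet.ncard = k}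

/-- On a finite vertex set the supremum defining `matchingNumber` bounds every matching. -/
theorem ncard_le_matchingNumber {V : Type*} [Finite V] (G : SimpleGraph V) (M : G.Subgraph)
    (hM : M.IsMatching) : M.edgeSet.ncard ≤ matchingNumber G := by
  refine le_csSup ⟨G.edgeSet.ncard, ?_⟩ ⟨M, hM, rfl⟩
  rintro k ⟨N, -, rfl⟩
  exact Set.ncard_le_ncard N.edgeSet_subset (Set.toFinite _)

/-- Adjacency lists of a bipartite graph with sides `V₁ = Fin n₁` and `V₂ = Fin n₂`: for every
node of `V₁` the list of its neighbours (heads of its outgoing arcs), for every node of `V₂` the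
list of its neighbours (tails of its incoming arcs), in arbitrary order. -/
structure AdjLists (n₁ n₂ : ℕ) where
  out : Fin n₁ → List (Fin n₂)
  inn : Fin n₂ → List (Fin n₁)

/-- The lists enumerate, without repetition, the neighbours of each node of `G`. -/
structure AdjLists.Represents {n₁ n₂ : ℕ} (L : AdjLists n₁ n₂)
    (G : SimpleGraph (Fin n₁ ⊕ Fin n₂)) : Prop where
  out_nodup : ∀ v, (L.out v).Nodup
  inn_nodup : ∀ w, (L.inn w).Nodup
  mem_out : ∀ v w, w ∈ L.out v ↔ G.Adj (Sum.inl v) (Sum.inr w)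
  mem_inn : ∀ v w, v ∈ L.inn w ↔ G.Adj (Sum.inl v) (Sum.inr w)

/-! ## The machine: random access memory with unit-cost instructions -/

/-- Addresses of the memory cells.

The branches of the normalized tree are stored by parent and child pointers. A node `v` of `V₁`
is a singleton (type `ST₁`) or a child of a node of `V₂`. A node `w` of `V₂` is the root of its
branch, with no child (type `WT₁`), with a `right` child only (type `WT₂`), or with a `left` and
a `right` child (type `ST₂`). Arcs between a root and its children carry one unit of flow and all
other arcs of the bipartite graph carry none. -/
inductive Addr (n₁ n₂ : ℕ) : Type
  /-- head of the linked list of neighbours of `v` (input) -/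
  | out (v : Fin n₁)
  /-- head of the linked list of neighbours of `w` (input) -/
  | inn (w : Fin n₂)
  /-- parent of `v` in its branch -/
  | parent (v : Fin n₁)
  /-- right child of `w` in its branch -/
  | right (w : Fin n₂)
  /-- left child of `w` in its branch -/
  | left (w : Fin n₂)
  /-- the label of `w`, with the number of the stage in which it was assigned -/
  | label (w : Fin n₂)
  /-- the last stage in which `v` was flagged as visited -/
  | visited₁ (v : Fin n₁)
  /-- the last stage in which `w` was flagged as visited -/
  | visited₂ (w : Fin n₂)
  /-- pointer of `v` to the last arc scanned in the search for a `WT₁` neighbour: a position in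
  the linked list of neighbours of `v`, given as the part of the list from there on -/
  | ptr (v : Fin n₁)
  deriving DecidableEq

/-- The contents of a cell: a node or nothing, a pointer into a linked list, or a bounded number
of integers. -/
abbrev Val {n₁ n₂ : ℕ} : Addr n₁ n₂ → Type
  | .out _ => List (Fin n₂)
  | .inn _ => List (Fin n₁)
  | .parent _ => Option (Fin n₂)
  | .right _ => Option (Fin n₁)
  | .left _ => Option (Fin n₁)
  | .label _ => ℕ × ℕ
  | .visited₁ _ => ℕ
  | .visited₂ _ => ℕ
  | .ptr _ => List (Fin n₂)

abbrev Mem (n₁ n₂ : ℕ) : Type := (a : Addr n₁ n₂) → Val a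

/-- The initial memory: the input, and otherwise constant contents, so that every node is a
singleton branch (the simple normalized tree) and nothing is labelled or visited. -/
def AdjLists.initialMem {n₁ n₂ : ℕ} (L : AdjLists n₁ n₂) : Mem n₁ n₂
  | .out v => L.out v
  | .inn w => L.inn w
  | .parent _ => none
  | .right _ => none
  | .left _ => none
  | .label _ => (0, 0)
  | .visited₁ _ => (0 : ℕ)
  | .visited₂ _ => (0 : ℕ)
  | .ptr _ => []

/-- Programs with a result in `α`. The instructions are: read one memory cell, write one memory
cell, and `tick`, one step that touches no memory cell (following the link of a linked list,
entering a loop or a procedure). -/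
inductive Prog (n₁ n₂ : ℕ) (α : Type) : Type
  | ret (x : α) : Prog n₁ n₂ α
  | tick (k : Prog n₁ n₂ α) : Prog n₁ n₂ α
  | read (a : Addr n₁ n₂) (k : Val a → Prog n₁ n₂ α) : Prog n₁ n₂ α
  | write (a : Addr n₁ n₂) (x : Val a) (k : Prog n₁ n₂ α) : Prog n₁ n₂ α

namespace Prog

variable {n₁ n₂ : ℕ} {α β : Type}

/-- Sequential composition. -/
def bind : Prog n₁ n₂ α → (α → Prog n₁ n₂ β) → Prog n₁ n₂ β
  | ret x, f => f x
  | tick k, f => tick (bind k f)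
  | read a k, f => read a (fun x => bind (k x) f)
  | write a x k, f => write a x (bind k f)

instance : Monad (Prog n₁ n₂) where
  pure := ret
  bind := bind

/-- Execution: result, final memory, and running time (number of executed instructions). -/
def run : Prog n₁ n₂ α → Mem n₁ n₂ → α × Mem n₁ n₂ × ℕ
  | ret x, s => (x, s, 0)
  | tick k, s =>
      let r := run k s
      (r.1, r.2.1, r.2.2 + 1)
  | read a k, s =>
      let r := run (k (s a)) s
      (r.1, r.2.1, r.2.2 + 1)
  | write a x k, s =>
      let r := run k (Function.update s a x)
      (r.1, r.2.1, r.2.2 + 1)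

/-- The memory after execution. -/
def finalMem (P : Prog n₁ n₂ α) (s : Mem n₁ n₂) : Mem n₁ n₂ := (run P s).2.1

/-- The running time. -/
def time (P : Prog n₁ n₂ α) (s : Mem n₁ n₂) : ℕ := (run P s).2.2

end Prog

section Algorithm

/-! ## The matching-pseudoflow algorithm

In the procedures below, only a bounded number of register operations (comparisons, arithmetic on
integers bounded by `n₁ + 1`, prepending one item to a list) happen between two
instructions, and every loop iteration and every procedure call executes at least one
instruction. The parameter `t` is the number of the current stage. A label is valid, and a
node counts as visited, only if the stage stored with it is `t`, so that all nodes become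
unlabelled and unvisited when `t` increases. -/

variable {n₁ n₂ : ℕ}

def tick : Prog n₁ n₂ Unit := .tick (.ret ())

def read (a : Addr n₁ n₂) : Prog n₁ n₂ (Val a) := .read a .ret

def write (a : Addr n₁ n₂) (x : Val a) : Prog n₁ n₂ Unit := .write a x (.ret ())

def getOut (v : Fin n₁) : Prog n₁ n₂ (List (Fin n₂)) := read (.out v)

def getInn (w : Fin n₂) : Prog n₁ n₂ (List (Fin n₁)) := read (.inn w)

def getParent (v : Fin n₁) : Prog n₁ n₂ (Option (Fin n₂)) := read (.parent v)

def getRight (w : Fin n₂) : Prog n₁ n₂ (Option (Fin n₁)) := read (.right w)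

def getLeft (w : Fin n₂) : Prog n₁ n₂ (Option (Fin n₁)) := read (.left w)

def isVisited₁ (t : ℕ) (v : Fin n₁) : Prog n₁ n₂ Bool := do
  let s : ℕ ← read (.visited₁ v)
  return decide (s = t)

def isVisited₂ (t : ℕ) (w : Fin n₂) : Prog n₁ n₂ Bool := do
  let s : ℕ ← read (.visited₂ w)
  return decide (s = t)

/-- The label of the branch rooted at `w`: `0` for a `WT₁` branch; otherwise the label assigned in
stage `t`, if any. Both nodes of a `WT₂` branch have the same label, which is stored at the root. -/
def getLabel (t : ℕ) (w : Fin n₂) : Prog n₁ n₂ (Option ℕ) := do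
  match ← getRight w with
  | none => return some 0
  | some _ =>
    let sk : ℕ × ℕ ← read (.label w)
    return if sk.1 = t then some sk.2 else none

/-- Merger over the arc from `v` to `w`, and renormalization. Here `v` is an `ST₁` branch (then
`x = none`) or the right child of an `ST₂` branch with root `x`; and `w` is the root of a `WT₁`
or `WT₂` branch. In the second case the excess is pushed over the arc between `x` and `v`, which
is split off: `x` stays behind as the root of a `WT₂` branch whose child is its left child. -/
def merger (x : Option (Fin n₂)) (v : Fin n₁) (w : Fin n₂) : Prog n₁ n₂ Unit := do
  match x with
  | none => tick
  | some x =>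
    let y ← getLeft x
    write (.right x) y
    write (.left x) none
  write (.parent v) (some w)
  match ← getRight w with
  | none => write (.right w) (some v)
  | some _ => write (.left w) (some v)

/-- Backtrack: reverses the merger from `v` to the root `w` of a `WT₂` branch. -/
def backtrack (x : Option (Fin n₂)) (v : Fin n₁) (w : Fin n₂) : Prog n₁ n₂ Unit := do
  write (.left w) none
  write (.parent v) x
  match x with
  | none => tick
  | some x =>
    let y ← getRight x
    write (.left x) y
    write (.right x) (some v)

/-- Scan the neighbours of `v`, from a given position in its list on, for a `WT₁` branch, and
save the position reached. -/
def seekWT₁ (v : Fin n₁) : List (Fin n₂) → Prog n₁ n₂ (Option (Fin n₂))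
  | [] => do
    write (.ptr v) ([] : List (Fin n₂))
    return none
  | w :: rest => do
    tick
    match ← getRight w with
    | none =>
      write (.ptr v) (w :: rest)
      return some w
    | some _ => seekWT₁ v rest

/-- Greedy initialization (stage 1). Returns the list of the children of the `WT₂` branches. -/
def greedy : List (Fin n₁) → Prog n₁ n₂ (List (Fin n₁))
  | [] => do
    tick
    return []
  | v :: vs => do
    tick
    let l ← getOut v
    match ← seekWT₁ v l with
    | none => greedy vs
    | some w =>
      merger none v w
      let c ← greedy vs
      return v :: c

/-- Generate the `1`-layer. Candidates are the children of the `WT₂` branches that had label `1`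
in the previous layered network; the scan of a candidate resumes at its saved pointer. Returns the
children and the roots of the branches in the layer. -/
def layerOne (t : ℕ) : List (Fin n₁) → Prog n₁ n₂ (List (Fin n₁) × List (Fin n₂))
  | [] => do
    tick
    return ([], [])
  | v :: vs => do
    tick
    let l : List (Fin n₂) ← read (.ptr v)
    match ← seekWT₁ v l with
    | none => layerOne t vs
    | some _ =>
      match ← getParent v with
      | none => layerOne t vs
      | some w =>
        write (.label w) (t, 1)
        let r ← layerOne t vs
        return (v :: r.1, w :: r.2)

/-- Scan the incoming arcs of the root of a `WT₂` branch in layer `p`. Unlabelled `WT₂` branches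
found receive the label `p + 1` and are added to the list `acc`. The scan stops, with `true`, as
soon as an `ST₁` neighbour is found. -/
def scanIncoming (t p : ℕ) : List (Fin n₁) → List (Fin n₂) → Prog n₁ n₂ (Bool × List (Fin n₂))
  | [], acc => do
    tick
    return (false, acc)
  | v :: rest, acc => do
    tick
    match ← getParent v with
    | none => return (true, acc)
    | some w =>
      match ← getLabel t w with
      | none =>
        write (.label w) (t, p + 1)
        scanIncoming t p rest (w :: acc)
      | some _ => scanIncoming t p rest acc

/-- Scan the incoming arcs of all roots in layer `p`, or until an `ST₁` neighbour is found. -/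
def scanLayer (t p : ℕ) : List (Fin n₂) → List (Fin n₂) → Prog n₁ n₂ (Bool × List (Fin n₂))
  | [], acc => do
    tick
    return (false, acc)
  | w :: ws, acc => do
    tick
    let l ← getInn w
    let r ← scanIncoming t p l acc
    if r.1 then return (true, r.2) else scanLayer t p ws r.2

/-- Breadth-first generation of the layers from layer `p` on, at most `b` of them. Returns `p` and
the roots in layer `p` for the first layer `p` with an `ST₁` neighbour (then the lowest label of
an `ST₁` branch is `ℓ = p + 1`), or `none` if no `ST₁` branch is reached. -/
def layers (t : ℕ) : ℕ → ℕ → List (Fin n₂) → Prog n₁ n₂ (Option (ℕ × List (Fin n₂)))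
  | 0, _, _ => do
    tick
    return none
  | _ + 1, _, [] => do
    tick
    return none
  | b + 1, p, w :: ws => do
    tick
    let r ← scanLayer t p (w :: ws) []
    if r.1 then return some (p, w :: ws) else layers t b (p + 1) r.2

/-- Search for mergers from `v` (of label `p + 1`, in the branch rooted at `x` unless it is `ST₁`)
to unvisited roots of label `p`, along the list of neighbours of `v`. The search continues, by
`next`, from the right child of the `ST₂` branch that a merger creates; if that fails, the merger
is reversed. Relabeling is delayed to the next stage. Returns whether a successful path was
completed. -/
def scanOut (t p : ℕ) (next : Fin n₁ → Prog n₁ n₂ Bool) (x : Option (Fin n₂)) (v : Fin n₁) :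
    List (Fin n₂) → Prog n₁ n₂ Bool
  | [] => do
    tick
    return false
  | w :: rest => do
    tick
    let vis ← isVisited₂ t w
    let lab ← getLabel t w
    if vis = false ∧ lab = some p then
      match ← getRight w with
      | none =>
        merger x v w
        write (.visited₂ w) t
        return true
      | some u =>
        merger x v w
        let success ← next u
        if success then
          write (.visited₂ w) t
          return true
        else
          backtrack x v w
          write (.visited₂ w) t
          scanOut t p next x v rest
    else
      scanOut t p next x v rest

/-- The sequences of mergers that start at `v`, where `v` has label `p`. -/
def search (t : ℕ) : ℕ → Fin n₁ → Prog n₁ n₂ Bool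
  | 0, _ => do
    tick
    return false
  | p + 1, v => do
    let x ← getParent v
    let l ← getOut v
    scanOut t p (search t p) x v l

/-- As long as the root `w` in layer `p` is unvisited, scan its incoming arcs for unvisited `ST₁`
neighbours (of label `p + 1`), and search for mergers from them. -/
def startFrom (t p : ℕ) (w : Fin n₂) : List (Fin n₁) → Prog n₁ n₂ Unit
  | [] => tick
  | v :: rest => do
    tick
    let visw ← isVisited₂ t w
    if visw then
      return ()
    else
      let x ← getParent v
      let visv ← isVisited₁ t v
      if x = none ∧ visv = false then
        let _success ← search t (p + 1) v
        write (.visited₁ v) t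
        startFrom t p w rest
      else
        startFrom t p w rest

/-- All mergers of a stage, given the roots in the last layer `p` of weak branches. -/
def stageMergers (t p : ℕ) : List (Fin n₂) → Prog n₁ n₂ Unit
  | [] => tick
  | w :: ws => do
    tick
    let l ← getInn w
    startFrom t p w l
    stageMergers t p ws

/-- The main loop: global relabeling, which generates a new layered network with everything
unvisited, and then the mergers of the stage; until no `ST₁` branch can reach a `WT₁` branch.
The list `cand` holds the candidates for the `1`-layer, and `b` bounds the number of stages. -/
def stages : ℕ → ℕ → List (Fin n₁) → Prog n₁ n₂ Unit
  | 0, _, _ => tick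
  | b + 1, t, cand => do
    tick
    let c ← layerOne t cand
    match ← layers t n₁ 1 c.2 with
    | none => return ()
    | some (p, layer) =>
      stageMergers t p layer
      stages b (t + 1) c.1

end Algorithm

/-- The matching-pseudoflow algorithm. Labels of `ST₁` branches and numbers of stages never
exceed `|V₁| = n₁`. -/
def algorithm (n₁ n₂ : ℕ) : Prog n₁ n₂ Unit := do
  let cand ← greedy (List.finRange n₁)
  stages n₁ 1 cand

/-- In the memory state `s`, the nodes `v` and `w` form a `WT₂` branch. -/
def IsWT₂ {n₁ n₂ : ℕ} (s : Mem n₁ n₂) (v : Fin n₁) (w : Fin n₂) : Prop :=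
  s (.parent v) = some w ∧ s (.right w) = some v ∧ s (.left w) = none

end MatchingPseudoflow

/-! The argument counts phases as for Hopcroft–Karp, but with vertex covers in place of families of
augmenting paths. A `LowerBound` `D`, `k` is a dual potential: it vanishes on the free nodes of
`V₂`, decreases by at most one from a root to any neighbour of its child, and is at least `k` next
to the free nodes of `V₁`. For `1 ≤ q ≤ k`, the children of the roots with `D ≤ q`, together with
the nodes of `V₂` with `D ≥ q`, cover all edges. Since such nodes overlap only at level `q`, weak
duality shows that the deficit `κ - msize` is at most the size of level `q`. Summing over the levels
gives `k * (κ - msize) ≤ κ` (`LowerBound.mul_deficit_le`).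

The breadth-first search of a stage produces labels that no lower bound can exceed (the field
`sharp` of `Layered`). The invariant `Layering.Inv` of the mergers says that the child of a visited
root either comes from the next layer or has only visited neighbours in the layer below. Hence
adding one to the labels of the visited roots gives a lower bound with `k = p + 1`
(`Layering.Between.lowerBound`). With an unchanged matching this would contradict sharpness, so
every stage enlarges the matching and raises the bound (`Layered.mergers_spec`). After about `√κ`
stages the deficit is itself at most about `√κ`; `stagePotential` turns this into `O(√κ)` stages. If
the search reaches no free node of `V₁`, the children of the labelled roots and the unlabelled roots
form a cover of the size of the matching, which is therefore maximum (`Layered.kappa_le`).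

A stage costs `O(min (κ ^ 2) m + 1)`. A scan of the list of a node of `V₁` passes only over roots
before it ends, so it has length at most `min deg κ + 1`. A root is visited at most once per stage,
so the scan of the list of its child can be prepaid (`Layering.debt`). A search from a free node
either enlarges the matching or visits a new root, so there are at most `2κ` of them, and incoming
arcs are scanned from at most `3κ` different tails. The greedy initialization scans the lists of all
of `V₁` once and accounts for the terms `min (n₁ * κ) m` and `n₁`. -/

namespace MatchingPseudoflow

/-! ## Reasoning about programs -/

section Programs

variable {n₁ n₂ : ℕ} {α β : Type}

/-- Running `P` from `s`, the result, the final memory and the running time satisfy `Q`. -/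
def Ensures (P : Prog n₁ n₂ α) (s : Mem n₁ n₂) (Q : α → Mem n₁ n₂ → ℕ → Prop) : Prop :=
  Q (P.run s).1 (P.run s).2.1 (P.run s).2.2

theorem Ensures.mono {P : Prog n₁ n₂ α} {s : Mem n₁ n₂} {Q Q' : α → Mem n₁ n₂ → ℕ → Prop}
    (h : Ensures P s Q) (hQ : ∀ x s' n, Q x s' n → Q' x s' n) : Ensures P s Q' :=
  hQ _ _ _ h

@[simp] theorem ensures_ret (x : α) (s : Mem n₁ n₂) (Q : α → Mem n₁ n₂ → ℕ → Prop) :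
    Ensures (pure x) s Q ↔ Q x s 0 := Iff.rfl

theorem run_bind (P : Prog n₁ n₂ α) (f : α → Prog n₁ n₂ β) (s : Mem n₁ n₂) :
    (P.bind f).run s =
      (((f (P.run s).1).run (P.run s).2.1).1, ((f (P.run s).1).run (P.run s).2.1).2.1,
        (P.run s).2.2 + ((f (P.run s).1).run (P.run s).2.1).2.2) := by
  induction P generalizing s with
  | ret x => simp [Prog.bind, Prog.run]
  | tick k ih => simp only [Prog.bind, Prog.run, ih]; congr 2; omega
  | read a k ih => simp only [Prog.bind, Prog.run, ih]; congr 2; omega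
  | write a x k ih => simp only [Prog.bind, Prog.run, ih]; congr 2; omega

@[simp] theorem ensures_bind (P : Prog n₁ n₂ α) (f : α → Prog n₁ n₂ β) (s : Mem n₁ n₂)
    (Q : β → Mem n₁ n₂ → ℕ → Prop) :
    Ensures (P >>= f) s Q ↔
      Ensures P s fun x s' n => Ensures (f x) s' fun y s'' n' => Q y s'' (n + n') := by
  change Q ((P.bind f).run s).1 ((P.bind f).run s).2.1 ((P.bind f).run s).2.2 ↔ _
  rw [run_bind]
  rfl

@[simp] theorem ensures_tick (s : Mem n₁ n₂) (Q : Unit → Mem n₁ n₂ → ℕ → Prop) :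
    Ensures tick s Q ↔ Q () s 1 := Iff.rfl

@[simp] theorem ensures_write (a : Addr n₁ n₂) (x : Val a) (s : Mem n₁ n₂)
    (Q : Unit → Mem n₁ n₂ → ℕ → Prop) :
    Ensures (write a x) s Q ↔ Q () (Function.update s a x) 1 := Iff.rfl

/-- Memory is a dependent function. The accessors from here on give each kind of cell a fixed type,
so that simplification can evaluate updates without casts. -/
def par (s : Mem n₁ n₂) (v : Fin n₁) : Option (Fin n₂) := s (.parent v)

def rt (s : Mem n₁ n₂) (w : Fin n₂) : Option (Fin n₁) := s (.right w)

def lf (s : Mem n₁ n₂) (w : Fin n₂) : Option (Fin n₁) := s (.left w)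

def lab (s : Mem n₁ n₂) (w : Fin n₂) : ℕ × ℕ := s (.label w)

def vis₁ (s : Mem n₁ n₂) (v : Fin n₁) : ℕ := s (.visited₁ v)

def vis₂ (s : Mem n₁ n₂) (w : Fin n₂) : ℕ := s (.visited₂ w)

def ptrAt (s : Mem n₁ n₂) (v : Fin n₁) : List (Fin n₂) := s (.ptr v)

def outAt (s : Mem n₁ n₂) (v : Fin n₁) : List (Fin n₂) := s (.out v)

def innAt (s : Mem n₁ n₂) (w : Fin n₂) : List (Fin n₁) := s (.inn w)

section Update

variable (s : Mem n₁ n₂) (a : Addr n₁ n₂) (x : Val a)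

@[simp] theorem par_update_of_ne {v} (h : a ≠ .parent v) :
    par (Function.update s a x) v = par s v := Function.update_of_ne h.symm _ _

@[simp] theorem rt_update_of_ne {w} (h : a ≠ .right w) :
    rt (Function.update s a x) w = rt s w := Function.update_of_ne h.symm _ _

@[simp] theorem lf_update_of_ne {w} (h : a ≠ .left w) :
    lf (Function.update s a x) w = lf s w := Function.update_of_ne h.symm _ _

@[simp] theorem lab_update_of_ne {w} (h : a ≠ .label w) :
    lab (Function.update s a x) w = lab s w := Function.update_of_ne h.symm _ _

@[simp] theorem vis₁_update_of_ne {v} (h : a ≠ .visited₁ v) :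
    vis₁ (Function.update s a x) v = vis₁ s v := Function.update_of_ne h.symm _ _

@[simp] theorem vis₂_update_of_ne {w} (h : a ≠ .visited₂ w) :
    vis₂ (Function.update s a x) w = vis₂ s w := Function.update_of_ne h.symm _ _

@[simp] theorem ptrAt_update_of_ne {v} (h : a ≠ .ptr v) :
    ptrAt (Function.update s a x) v = ptrAt s v := Function.update_of_ne h.symm _ _

@[simp] theorem outAt_update_of_ne {v} (h : a ≠ .out v) :
    outAt (Function.update s a x) v = outAt s v := Function.update_of_ne h.symm _ _

@[simp] theorem innAt_update_of_ne {w} (h : a ≠ .inn w) :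
    innAt (Function.update s a x) w = innAt s w := Function.update_of_ne h.symm _ _

@[simp] theorem par_update (v v' : Fin n₁) (y : Option (Fin n₂)) :
    par (Function.update s (.parent v) y) v' = if v' = v then y else par s v' := by
  unfold par; split_ifs with h
  · subst h; exact Function.update_self ..
  · exact Function.update_of_ne (by simpa using h) _ _

@[simp] theorem rt_update (w w' : Fin n₂) (y : Option (Fin n₁)) :
    rt (Function.update s (.right w) y) w' = if w' = w then y else rt s w' := by
  unfold rt; split_ifs with h
  · subst h; exact Function.update_self ..
  · exact Function.update_of_ne (by simpa using h) _ _

@[simp] theorem lf_update (w w' : Fin n₂) (y : Option (Fin n₁)) :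
    lf (Function.update s (.left w) y) w' = if w' = w then y else lf s w' := by
  unfold lf; split_ifs with h
  · subst h; exact Function.update_self ..
  · exact Function.update_of_ne (by simpa using h) _ _

@[simp] theorem lab_update (w w' : Fin n₂) (y : ℕ × ℕ) :
    lab (Function.update s (.label w) y) w' = if w' = w then y else lab s w' := by
  unfold lab; split_ifs with h
  · subst h; exact Function.update_self ..
  · exact Function.update_of_ne (by simpa using h) _ _

@[simp] theorem vis₁_update (v v' : Fin n₁) (y : ℕ) :
    vis₁ (Function.update s (.visited₁ v) y) v' = if v' = v then y else vis₁ s v' := by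
  unfold vis₁; split_ifs with h
  · subst h; exact Function.update_self ..
  · exact Function.update_of_ne (by simpa using h) _ _

@[simp] theorem vis₂_update (w w' : Fin n₂) (y : ℕ) :
    vis₂ (Function.update s (.visited₂ w) y) w' = if w' = w then y else vis₂ s w' := by
  unfold vis₂; split_ifs with h
  · subst h; exact Function.update_self ..
  · exact Function.update_of_ne (by simpa using h) _ _

@[simp] theorem ptrAt_update (v v' : Fin n₁) (y : List (Fin n₂)) :
    ptrAt (Function.update s (.ptr v) y) v' = if v' = v then y else ptrAt s v' := by
  unfold ptrAt; split_ifs with h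
  · subst h; exact Function.update_self ..
  · exact Function.update_of_ne (by simpa using h) _ _

end Update

variable (s : Mem n₁ n₂)

@[simp] theorem ensures_getOut (v : Fin n₁) (Q : List (Fin n₂) → Mem n₁ n₂ → ℕ → Prop) :
    Ensures (getOut v) s Q ↔ Q (outAt s v) s 1 := Iff.rfl

@[simp] theorem ensures_getInn (w : Fin n₂) (Q : List (Fin n₁) → Mem n₁ n₂ → ℕ → Prop) :
    Ensures (getInn w) s Q ↔ Q (innAt s w) s 1 := Iff.rfl

@[simp] theorem ensures_getParent (v : Fin n₁) (Q : Option (Fin n₂) → Mem n₁ n₂ → ℕ → Prop) :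
    Ensures (getParent v) s Q ↔ Q (par s v) s 1 := Iff.rfl

@[simp] theorem ensures_getRight (w : Fin n₂) (Q : Option (Fin n₁) → Mem n₁ n₂ → ℕ → Prop) :
    Ensures (getRight w) s Q ↔ Q (rt s w) s 1 := Iff.rfl

@[simp] theorem ensures_getLeft (w : Fin n₂) (Q : Option (Fin n₁) → Mem n₁ n₂ → ℕ → Prop) :
    Ensures (getLeft w) s Q ↔ Q (lf s w) s 1 := Iff.rfl

@[simp] theorem ensures_isVisited₁ (t : ℕ) (v : Fin n₁) (Q : Bool → Mem n₁ n₂ → ℕ → Prop) :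
    Ensures (isVisited₁ t v) s Q ↔ Q (decide (vis₁ s v = t)) s 1 := Iff.rfl

@[simp] theorem ensures_isVisited₂ (t : ℕ) (w : Fin n₂) (Q : Bool → Mem n₁ n₂ → ℕ → Prop) :
    Ensures (isVisited₂ t w) s Q ↔ Q (decide (vis₂ s w = t)) s 1 := Iff.rfl

theorem ensures_readPtr (v : Fin n₁) (Q : List (Fin n₂) → Mem n₁ n₂ → ℕ → Prop) :
    Ensures (read (.ptr v)) s Q ↔ Q (ptrAt s v) s 1 := Iff.rfl

/-- The label that `getLabel` reads. -/
def labelAt (t : ℕ) (s : Mem n₁ n₂) (w : Fin n₂) : Option ℕ :=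
  match rt s w with
  | none => some 0
  | some _ => if (lab s w).1 = t then some (lab s w).2 else none

/-- The two branches of `getLabel` take different times, so the number of steps is only bounded. -/
theorem ensures_getLabel {s : Mem n₁ n₂} {t : ℕ} {w : Fin n₂} {Q : Option ℕ → Mem n₁ n₂ → ℕ → Prop}
    (h : ∀ n ≤ 2, Q (labelAt t s w) s n) : Ensures (getLabel t w) s Q := by
  unfold getLabel
  simp only [ensures_bind, ensures_getRight]
  cases hr : rt s w with
  | none => simpa [labelAt, hr] using h 1 (by omega)
  | some u =>
    simp only [ensures_bind, ensures_ret]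
    have := h 2 le_rfl
    simp only [labelAt, hr] at this
    exact this

end Programs

end MatchingPseudoflow

namespace MatchingPseudoflow

/-! ## Matchings stored in memory -/

section Matchings

variable {n₁ n₂ : ℕ}

/-- The adjacency lists are coherent, `m` bounds the number of arcs, and `κ` is the maximum size of
a matching, with König's bound by vertex covers. -/
structure AdjLists.Sizes (L : AdjLists n₁ n₂) (m κ : ℕ) : Prop where
  out_nodup : ∀ v, (L.out v).Nodup
  inn_nodup : ∀ w, (L.inn w).Nodup
  mem_inn : ∀ v w, v ∈ L.inn w ↔ w ∈ L.out v
  sum_out : ∑ v, (L.out v).length ≤ m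
  sum_inn : ∑ w, (L.inn w).length ≤ m
  card_le : ∀ f : Fin n₁ → Option (Fin n₂), (∀ v w, f v = some w → w ∈ L.out v) →
    (∀ v v' w, f v = some w → f v' = some w → v = v') →
      (Finset.univ.filter fun v => f v ≠ none).card ≤ κ
  le_cover : ∀ (A : Finset (Fin n₁)) (B : Finset (Fin n₂)),
    (∀ v w, w ∈ L.out v → v ∈ A ∨ w ∈ B) → κ ≤ A.card + B.card

/-- The memory holds the input, and all its branches are of the types `ST₁`, `WT₁` and `WT₂`. -/
structure IsMatch (L : AdjLists n₁ n₂) (s : Mem n₁ n₂) : Prop where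
  out : ∀ v, outAt s v = L.out v
  inn : ∀ w, innAt s w = L.inn w
  par_iff : ∀ v w, par s v = some w ↔ rt s w = some v
  left : ∀ w, lf s w = none
  edge : ∀ v w, par s v = some w → w ∈ L.out v

/-- The number of matched nodes of `V₁`. -/
def msize (s : Mem n₁ n₂) : ℕ := (Finset.univ.filter fun v => par s v ≠ none).card

/-- The roots of `WT₂` branches. -/
def roots (s : Mem n₁ n₂) : Finset (Fin n₂) := Finset.univ.filter fun w => rt s w ≠ none

@[simp] theorem mem_roots {s : Mem n₁ n₂} {w : Fin n₂} : w ∈ roots s ↔ rt s w ≠ none := by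
  simp [roots]

variable {L : AdjLists n₁ n₂} {m κ : ℕ} {s : Mem n₁ n₂}

/-- The parent map is a bijection from the matched nodes of `V₁` to the roots of `WT₂` branches, so
conditions may be counted on either side. -/
theorem IsMatch.card_filter (h : IsMatch L s) (q : Fin n₁ → Prop) (r : Fin n₂ → Prop)
    [DecidablePred q] [DecidablePred r] (hqr : ∀ v w, par s v = some w → (q v ↔ r w)) :
    (Finset.univ.filter fun v => par s v ≠ none ∧ q v).card =
      ((roots s).filter r).card := by
  refine Finset.card_bij (fun v hv => (par s v).get
    (Option.isSome_iff_ne_none.2 (Finset.mem_filter.1 hv).2.1)) ?_ ?_ ?_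
  · intro v hv
    simp only [Finset.mem_filter, Finset.mem_univ, true_and] at hv
    obtain ⟨w, hw⟩ := Option.ne_none_iff_exists'.1 hv.1
    simp only [hw, Option.get_some, Finset.mem_filter, mem_roots, (h.par_iff v w).1 hw]
    exact ⟨by simp, (hqr v w hw).1 hv.2⟩
  · intro v hv v' hv' e
    simp only [Finset.mem_filter, Finset.mem_univ, true_and] at hv hv'
    obtain ⟨w, hw⟩ := Option.ne_none_iff_exists'.1 hv.1
    obtain ⟨w', hw'⟩ := Option.ne_none_iff_exists'.1 hv'.1
    simp only [hw, hw', Option.get_some] at e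
    subst e
    have := (h.par_iff v w).1 hw
    rw [(h.par_iff v' w).1 hw'] at this
    exact (Option.some.inj this).symm
  · intro w hw
    simp only [Finset.mem_filter, mem_roots] at hw
    obtain ⟨v, hv⟩ := Option.ne_none_iff_exists'.1 hw.1
    have hp := (h.par_iff v w).2 hv
    exact ⟨v, by simp [hp, (hqr v w hp).2 hw.2], by simp [hp]⟩

theorem IsMatch.card_roots (h : IsMatch L s) : (roots s).card = msize s := by
  have := h.card_filter (fun _ => True) (fun _ => True) (fun _ _ _ => Iff.rfl)
  simpa [msize] using this.symm

theorem IsMatch.msize_le (h : IsMatch L s) (hL : L.Sizes m κ) : msize s ≤ κ := by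
  refine hL.card_le (par s) h.edge fun v v' w hv hv' => ?_
  rw [h.par_iff] at hv hv'
  exact Option.some.inj (hv.symm.trans hv')

theorem msize_le_left (s : Mem n₁ n₂) : msize s ≤ n₁ := by
  simpa [msize] using Finset.card_filter_le (Finset.univ : Finset (Fin n₁)) fun v => par s v ≠ none

/-- The vertex cover that cuts the graph at a set `R` of roots: the children of the roots in `R`,
and the nodes of `V₂` in `T`. -/
theorem IsMatch.kappa_le (h : IsMatch L s) (hL : L.Sizes m κ) (R T : Finset (Fin n₂))
    (hc : ∀ v w, w ∈ L.out v → w ∉ T → ∃ x ∈ R, par s v = some x) :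
    κ ≤ ((roots s).filter (· ∈ R)).card + T.card := by
  classical
  refine (hL.le_cover (Finset.univ.filter fun v => par s v ≠ none ∧ ∃ x ∈ R, par s v = some x) T
    fun v w hw => ?_).trans_eq ?_
  · by_cases hT : w ∈ T
    · exact Or.inr hT
    · obtain ⟨x, hx, hp⟩ := hc v w hw hT
      exact Or.inl (by simp [hp, hx])
  · rw [h.card_filter (fun v => ∃ x ∈ R, par s v = some x) (· ∈ R)]
    intro v w hv
    simp [hv]

/-- `D` is a lower bound for the distance labels, and `k` for the labels of the neighbours of `ST₁`
branches. -/
structure LowerBound (L : AdjLists n₁ n₂) (s : Mem n₁ n₂) (D : Fin n₂ → ℕ) (k : ℕ) : Prop where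
  zero : ∀ w, rt s w = none → D w = 0
  step : ∀ v x w, par s v = some x → w ∈ L.out v → D x ≤ D w + 1
  excess : ∀ v w, par s v = none → w ∈ L.out v → k ≤ D w

/-- Cut the graph at level `q`. An edge from `v` to a node with `D < q` forces the parent of `v` to
exist, because `q ≤ k`, and to have `D ≤ q`; so `v` is in the cover. -/
theorem LowerBound.deficit_le_layer {D : Fin n₂ → ℕ} {k q : ℕ} (hD : LowerBound L s D k)
    (h : IsMatch L s) (hL : L.Sizes m κ) (hq : 1 ≤ q) (hqk : q ≤ k) :
    κ ≤ msize s + ((roots s).filter fun w => D w = q).card := by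
  have hpos : ∀ w, q ≤ D w → w ∈ roots s := by
    intro w hw
    by_contra hn
    have := hD.zero w (by simpa using hn)
    omega
  have hcover := h.kappa_le hL (Finset.univ.filter fun w => D w ≤ q)
    (Finset.univ.filter fun w => q ≤ D w) (by
      intro v w hw hT
      simp only [Finset.mem_filter, Finset.mem_univ, true_and, not_le] at hT
      cases hp : par s v with
      | none => have := hD.excess v w hp hw; omega
      | some x =>
        have := hD.step v x w hp hw
        exact ⟨x, by simp; omega, rfl⟩)
  refine hcover.trans ?_
  -- Inclusion–exclusion: the union of the two parts consists of roots, because `q ≥ 1`, and their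
  -- intersection lies in level `q`.
  rw [← h.card_roots, ← Finset.card_union_add_card_inter]
  refine add_le_add (Finset.card_le_card fun w hw => ?_) (Finset.card_le_card fun w hw => ?_)
  · simp only [Finset.mem_union, Finset.mem_filter, Finset.mem_univ, true_and] at hw
    rcases hw with hw | hw
    · exact hw.1
    · exact hpos w hw
  · simp only [Finset.mem_inter, Finset.mem_filter, Finset.mem_univ, true_and] at hw ⊢
    exact ⟨hw.1.1, by omega⟩

/-- Levels `1` to `k` are disjoint sets of roots, each at least as large as the deficit, and there
are at most `κ` roots in all. -/
theorem LowerBound.mul_deficit_le {D : Fin n₂ → ℕ} {k : ℕ} (hD : LowerBound L s D k)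
    (h : IsMatch L s) (hL : L.Sizes m κ) : k * (κ - msize s) ≤ κ := by
  have h1 : ∑ q ∈ Finset.Icc 1 k, (κ - msize s) ≤
      ∑ q ∈ Finset.Icc 1 k, ((roots s).filter fun w => D w = q).card := by
    refine Finset.sum_le_sum fun q hq => ?_
    rw [Finset.mem_Icc] at hq
    have := hD.deficit_le_layer h hL hq.1 hq.2
    omega
  simp only [Finset.sum_const, Nat.card_Icc, smul_eq_mul, Nat.add_sub_cancel] at h1
  refine h1.trans (le_trans ?_ (h.msize_le hL))
  rw [← h.card_roots]
  refine (Finset.card_biUnion ?_).symm.trans_le (Finset.card_le_card ?_)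
  · intro a _ b _ hab
    refine Finset.disjoint_left.2 fun w hw hw' => hab ?_
    exact (Finset.mem_filter.1 hw).2.symm.trans (Finset.mem_filter.1 hw').2
  · exact Finset.biUnion_subset.2 fun q _ => Finset.filter_subset _ _

/-! ### Lengths of scans -/

/-- The number of arcs scanned in the list of `v` until the first `WT₁` neighbour is found. -/
def scanBound (L : AdjLists n₁ n₂) (κ : ℕ) (v : Fin n₁) : ℕ := min (L.out v).length κ + 1

/-- A duplicate-free list contains at most `κ` roots. The extra one accounts for the arc, or the end
of the list, where a scan stops. -/
theorem length_filter_roots_le (h : IsMatch L s) (hL : L.Sizes m κ) {v : Fin n₁}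
    {l : List (Fin n₂)} (hl : l.Sublist (L.out v)) :
    (l.filter fun w => rt s w ≠ none).length + 1 ≤ scanBound L κ v := by
  refine Nat.succ_le_succ (le_min ((List.length_filter_le _ _).trans hl.length_le) ?_)
  rw [← List.toFinset_card_of_nodup (((hL.out_nodup v).sublist hl).filter _)]
  refine (Finset.card_le_card (t := roots s) fun w hw => ?_).trans
    (h.card_roots.trans_le (h.msize_le hL))
  simp only [List.mem_toFinset, List.mem_filter, decide_eq_true_eq] at hw
  simpa using hw.2

theorem length_filter_le {w : Fin n₂} {l : List (Fin n₁)} (hL : L.Sizes m κ)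
    (hl : l.Sublist (L.inn w)) (A : Finset (Fin n₁)) :
    (l.filter (· ∈ A)).length ≤ min (L.inn w).length A.card := by
  refine le_min ((List.length_filter_le _ _).trans hl.length_le) ?_
  rw [← List.toFinset_card_of_nodup (((hL.inn_nodup w).sublist hl).filter _)]
  exact Finset.card_le_card fun v hv => by simpa using (List.mem_filter.1 (List.mem_toFinset.1 hv)).2

theorem sum_min_le {ι : Type*} [Fintype ι] (A : Finset ι) (f : ι → ℕ) (k : ℕ) (hf : ∑ i, f i ≤ m) :
    ∑ i ∈ A, min (f i) k ≤ min m (A.card * k) := by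
  refine le_min ?_ ?_
  · exact (Finset.sum_le_sum fun i _ => min_le_left _ _).trans
      ((Finset.sum_le_sum_of_subset (Finset.subset_univ A)).trans hf)
  · exact (Finset.sum_le_sum fun i _ => min_le_right (f i) k).trans_eq (by simp)

theorem sum_scanBound_le (hL : L.Sizes m κ) (A : Finset (Fin n₁)) :
    ∑ v ∈ A, scanBound L κ v ≤ min m (A.card * κ) + A.card := by
  simp only [scanBound, Finset.sum_add_distrib, Finset.sum_const, smul_eq_mul, mul_one]
  exact Nat.add_le_add_right (sum_min_le A _ κ hL.sum_out) _

end Matchings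

end MatchingPseudoflow

namespace MatchingPseudoflow

/-! ## Mergers along the layered network -/

section Mergers

variable {n₁ n₂ : ℕ}

/-- The memory `s'` agrees with `s` outside the cells in `K`. -/
def EqOff (K : Addr n₁ n₂ → Prop) (s s' : Mem n₁ n₂) : Prop := ∀ a, ¬ K a → s' a = s a

/-- The cells of the visited flags of `V₂`. -/
def VisitedCell : Addr n₁ n₂ → Prop
  | .visited₂ _ => True
  | _ => False

/-- The cells that mergers and their backtracks write. -/
def MergerCell : Addr n₁ n₂ → Prop
  | .parent _ => True
  | .right _ => True
  | .left _ => True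
  | .visited₂ _ => True
  | _ => False

theorem EqOff.trans {K : Addr n₁ n₂ → Prop} {s s' s'' : Mem n₁ n₂} (h : EqOff K s s')
    (h' : EqOff K s' s'') : EqOff K s s'' := fun a ha => (h' a ha).trans (h a ha)

theorem EqOff.mono {K K' : Addr n₁ n₂ → Prop} {s s' : Mem n₁ n₂} (h : EqOff K s s')
    (hK : ∀ a, K a → K' a) : EqOff K' s s' := fun a ha => h a fun hk => ha (hK a hk)

theorem EqOff.update {K : Addr n₁ n₂ → Prop} {s s' : Mem n₁ n₂} (h : EqOff K s s')
    (a : Addr n₁ n₂) (x : Val a) (ha : K a) : EqOff K s (Function.update s' a x) := by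
  intro b hb
  rw [Function.update_of_ne, h b hb]
  rintro rfl
  exact hb ha

theorem EqOff.refl (K : Addr n₁ n₂ → Prop) (s : Mem n₁ n₂) : EqOff K s s := fun _ _ => rfl

theorem VisitedCell.mergerCell (a : Addr n₁ n₂) (h : VisitedCell a) : MergerCell a := by
  cases a <;> simp_all [VisitedCell, MergerCell]

theorem eqOff_visitedCell_iff {s s' : Mem n₁ n₂} : EqOff VisitedCell s s' ↔
    (∀ v, par s' v = par s v) ∧ (∀ w, rt s' w = rt s w) ∧ (∀ w, lf s' w = lf s w) ∧
      (∀ w, lab s' w = lab s w) ∧ (∀ v, vis₁ s' v = vis₁ s v) ∧ (∀ v, ptrAt s' v = ptrAt s v) ∧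
        (∀ v, outAt s' v = outAt s v) ∧ ∀ w, innAt s' w = innAt s w := by
  constructor
  · intro h
    exact ⟨fun v => h (.parent v) id, fun w => h (.right w) id, fun w => h (.left w) id,
      fun w => h (.label w) id, fun v => h (.visited₁ v) id, fun v => h (.ptr v) id,
      fun v => h (.out v) id, fun w => h (.inn w) id⟩
  · rintro ⟨h1, h2, h3, h4, h5, h6, h7, h8⟩ a ha
    cases a with
    | out v => exact h7 v
    | inn w => exact h8 w
    | parent v => exact h1 v
    | right w => exact h2 w
    | left w => exact h3 w
    | label w => exact h4 w
    | visited₁ v => exact h5 v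
    | visited₂ w => exact absurd trivial ha
    | ptr v => exact h6 v

/-- Splitting off the excess node `v` from its branch, if it is not a singleton. -/
def detach (v : Fin n₁) (s : Mem n₁ n₂) : Mem n₁ n₂ :=
  match par s v with
  | none => s
  | some x =>
    Function.update (Function.update (Function.update s (.right x) (lf s x)) (.left x)
      (none : Option (Fin n₁))) (.parent v) (none : Option (Fin n₂))

section Detach

variable (v : Fin n₁) (s : Mem n₁ n₂)

theorem par_detach (v' : Fin n₁) :
    par (detach v s) v' = if v' = v then none else par s v' := by
  unfold detach; split <;> rename_i h
  · split_ifs with h' <;> simp_all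
  · simp

theorem rt_detach (w : Fin n₂) :
    rt (detach v s) w = if par s v = some w then lf s w else rt s w := by
  unfold detach; split <;> rename_i x h
  · simp [h]
  · simp [h, eq_comm]
    split_ifs with h' <;> simp [h']

theorem lf_detach (w : Fin n₂) :
    lf (detach v s) w = if par s v = some w then none else lf s w := by
  unfold detach; split <;> rename_i x h
  · simp [h]
  · simp [h, eq_comm]

@[simp] theorem lab_detach (w : Fin n₂) : lab (detach v s) w = lab s w := by
  unfold detach; split <;> simp

@[simp] theorem vis₂_detach (w : Fin n₂) : vis₂ (detach v s) w = vis₂ s w := by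
  unfold detach; split <;> simp

@[simp] theorem outAt_detach (v' : Fin n₁) : outAt (detach v s) v' = outAt s v' := by
  unfold detach; split <;> simp

@[simp] theorem innAt_detach (w : Fin n₂) : innAt (detach v s) w = innAt s w := by
  unfold detach; split <;> simp

theorem eqOff_detach : EqOff MergerCell s (detach v s) := by
  unfold detach; split
  · exact EqOff.refl _ _
  · exact (((EqOff.refl _ _).update _ _ trivial).update _ _ trivial).update _ _ trivial

end Detach

/-- Expressing a merger through `detach` treats the singleton and the `ST₂` case alike: the excess
node is first split off, then attached to `w`. -/
theorem ensures_merger_root {s : Mem n₁ n₂} {v : Fin n₁} {w : Fin n₂}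
    {Q : Unit → Mem n₁ n₂ → ℕ → Prop} (h : rt (detach v s) w = none)
    (hQ : ∀ n ≤ 7, Q () (Function.update (Function.update (detach v s) (.parent v) (some w))
      (.right w) (some v)) n) :
    Ensures (merger (par s v) v w) s Q := by
  unfold merger
  unfold detach at h hQ
  cases hp : par s v with
  | none =>
    simp only [hp] at h hQ
    simp [h]
    exact hQ _ (by norm_num)
  | some x =>
    simp [hp] at h hQ
    simp [h]
    exact hQ _ (by norm_num)

theorem ensures_merger_branch {s : Mem n₁ n₂} {v u : Fin n₁} {w : Fin n₂}
    {Q : Unit → Mem n₁ n₂ → ℕ → Prop} (h : rt (detach v s) w = some u)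
    (hQ : ∀ n ≤ 7, Q () (Function.update (Function.update (detach v s) (.parent v) (some w))
      (.left w) (some v)) n) :
    Ensures (merger (par s v) v w) s Q := by
  unfold merger
  unfold detach at h hQ
  cases hp : par s v with
  | none =>
    simp only [hp] at h hQ
    simp [h]
    exact hQ _ (by norm_num)
  | some x =>
    simp [hp] at h hQ
    simp [h]
    exact hQ _ (by norm_num)

/-- Backtracking inverts the merger exactly because `w` had no left child and `v` was the right
child of its root. The only remaining traces of the failed search are visited flags. -/
theorem ensures_backtrack {s s' : Mem n₁ n₂} {v : Fin n₁} {w : Fin n₂}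
    {Q : Unit → Mem n₁ n₂ → ℕ → Prop} (hw : lf s w = none)
    (hv : ∀ x, par s v = some x → rt s x = some v ∧ x ≠ w)
    (hs' : EqOff VisitedCell (Function.update (Function.update (detach v s) (.parent v) (some w))
      (.left w) (some v)) s')
    (hQ : ∀ s'' n, n ≤ 5 → EqOff VisitedCell s s'' → (∀ w, vis₂ s'' w = vis₂ s' w) →
      Q () s'' n) :
    Ensures (backtrack (par s v) v w) s' Q := by
  unfold backtrack
  unfold detach at hs'
  cases hp : par s v with
  | none =>
    simp only [hp] at hs'
    rw [eqOff_visitedCell_iff] at hs'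
    simp at hs'
    obtain ⟨h1, h2, h3, h4, h5, h6, h7, h8⟩ := hs'
    simp
    refine hQ _ _ (by norm_num) (eqOff_visitedCell_iff.2 ?_) (by simp)
    simp [h1, h2, h3, h4, h5, h6, h7, h8]
    grind
  | some x =>
    simp [hp] at hs'
    rw [eqOff_visitedCell_iff] at hs'
    simp at hs'
    obtain ⟨h1, h2, h3, h4, h5, h6, h7, h8⟩ := hs'
    simp
    refine hQ _ _ (by norm_num) (eqOff_visitedCell_iff.2 ?_) (by simp)
    simp [h1, h2, h3, h4, h5, h6, h7, h8]
    grind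

/-- A layered network: the labels `d` of the roots (those of layers above `p` all being `p + 1`),
the labels `lam` of the nodes of `V₁`, the children of the roots, and the contents of the label
cells, at the beginning of the mergers of stage `t`. -/
structure Layering (L : AdjLists n₁ n₂) where
  t : ℕ
  p : ℕ
  d : Fin n₂ → ℕ
  lam : Fin n₁ → ℕ
  child : Fin n₂ → Option (Fin n₁)
  cell : Fin n₂ → ℕ × ℕ
  lam_le : ∀ v w, w ∈ L.out v → lam v ≤ d w + 1
  one_le_lam : ∀ v, 1 ≤ lam v
  lam_child : ∀ w u, child w = some u → lam u = d w
  cell_iff : ∀ w q, d w ≠ 0 → q ≤ p → ((cell w).1 = t ∧ (cell w).2 = q ↔ d w = q)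

variable {L : AdjLists n₁ n₂} (Λ : Layering L)

/-- All nodes of `l` in the layer below `v` are visited. -/
def Layering.Closed (s : Mem n₁ n₂) (v : Fin n₁) (l : List (Fin n₂)) : Prop :=
  ∀ w ∈ l, Λ.d w + 1 = Λ.lam v → vis₂ s w = Λ.t

/-- The invariant of the mergers of a stage. Roots in layers below `q` keep their children until
they are visited; the child of a visited root was replaced by a node of the next layer, or a search
from it has failed. -/
structure Layering.Inv (q : ℕ) (s : Mem n₁ n₂) : Prop where
  isMatch : IsMatch L s
  cell : ∀ w, lab s w = Λ.cell w
  zero : ∀ w, Λ.d w = 0 → (vis₂ s w = Λ.t ↔ rt s w ≠ none)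
  pos : ∀ w, Λ.d w ≠ 0 → rt s w ≠ none
  unvisited : ∀ w, Λ.d w < q → vis₂ s w ≠ Λ.t → rt s w = Λ.child w
  visited : ∀ w u, vis₂ s w = Λ.t → rt s w = some u →
    (Λ.lam u = Λ.d w ∧ Λ.Closed s u (L.out u)) ∨ Λ.lam u = Λ.d w + 1

/-- The excess is at `v`, of label `q`, whose detachment leaves a matching. -/
structure Layering.Excess (q : ℕ) (s : Mem n₁ n₂) (v : Fin n₁) : Prop where
  inv : Λ.Inv q (detach v s)
  lam : Λ.lam v = q
  holder : ∀ x, par s v = some x → rt s x = some v ∧ Λ.d x = q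

/-- The effect of a search from `v` of label `q`, along the part `l` of its list, from memory `s`
to memory `s'`. -/
structure Layering.Searched (q : ℕ) (v : Fin n₁) (l : List (Fin n₂)) (s : Mem n₁ n₂)
    (success : Bool) (s' : Mem n₁ n₂) : Prop where
  flags : ∀ w, vis₂ s' w = Λ.t ∨ vis₂ s' w = vis₂ s w
  high : ∀ w, q ≤ Λ.d w → vis₂ s' w = vis₂ s w
  eqOff : success = false → EqOff VisitedCell s s'
  inv_fail : success = false → Λ.Inv q (detach v s')
  closed : success = false → Λ.Closed s' v l
  inv : success = true → Λ.Inv q s'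
  par_iff : success = true → ∀ v', par s' v' ≠ none ↔ par s v' ≠ none ∨ v' = v
  rt_high : success = true → ∀ w, q ≤ Λ.d w → rt s' w = rt (detach v s) w
  eqOff' : EqOff MergerCell s s'

variable {Λ} in
theorem Layering.Searched.mono {q : ℕ} {v : Fin n₁} {l : List (Fin n₂)} {s s' : Mem n₁ n₂}
    {b : Bool} (h : Λ.Searched q v l s b s') (w : Fin n₂) (hw : vis₂ s w = Λ.t) :
    vis₂ s' w = Λ.t :=
  (h.flags w).elim id fun hh => hh.trans hw

/-- The cost of scanning the lists of the children of unvisited roots. -/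
def Layering.debt (κ : ℕ) (s : Mem n₁ n₂) : ℕ :=
  ∑ w, if vis₂ s w = Λ.t then 0 else ((Λ.child w).map (scanBound L κ)).getD 0

variable {Λ}

theorem Layering.Inv.mono {q q' : ℕ} {s : Mem n₁ n₂} (h : Λ.Inv q s) (hq : q' ≤ q) : Λ.Inv q' s :=
  ⟨h.isMatch, h.cell, h.zero, h.pos, fun w hw => h.unvisited w (hw.trans_le hq), h.visited⟩

theorem IsMatch.congr {s s' : Mem n₁ n₂} (h : IsMatch L s) (hout : ∀ v, outAt s' v = outAt s v)
    (hinn : ∀ w, innAt s' w = innAt s w) (hpar : ∀ v, par s' v = par s v)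
    (hrt : ∀ w, rt s' w = rt s w) (hlf : ∀ w, lf s' w = lf s w) : IsMatch L s' :=
  ⟨fun v => (hout v).trans (h.out v), fun w => (hinn w).trans (h.inn w),
    fun v w => by rw [hpar, hrt]; exact h.par_iff v w, fun w => (hlf w).trans (h.left w),
    fun v w => by rw [hpar]; exact h.edge v w⟩

/-- Detaching `v` promotes the left child of its root, which exists by the field `pos` because the
root is in a positive layer. So the set of roots without a child does not change. -/
theorem Layering.Excess.rt_eq_none_iff {q : ℕ} {s : Mem n₁ n₂} {v : Fin n₁}
    (h : Λ.Excess q s v) (w : Fin n₂) : rt s w = none ↔ rt (detach v s) w = none := by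
  have hq : q ≠ 0 := by have := Λ.one_le_lam v; have := h.lam; omega
  by_cases hp : par s v = some w
  · have h1 := (h.holder w hp).1
    have h2 := h.inv.pos w (by rw [(h.holder w hp).2]; exact hq)
    simp [h1, h2]
  · rw [rt_detach, if_neg hp]

/-- The test of the program agrees with the abstract layer. In layer `0` this relies on unvisited
nodes still having no child; capped labels do no harm, because only values `q ≤ p` are compared. -/
theorem Layering.Excess.labelAt_iff {q : ℕ} {s : Mem n₁ n₂} {v : Fin n₁}
    (h : Λ.Excess (q + 1) s v) (hq : q ≤ Λ.p) {w : Fin n₂} (hw : vis₂ s w ≠ Λ.t) :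
    labelAt Λ.t s w = some q ↔ Λ.d w = q := by
  have hc : lab s w = Λ.cell w := by simpa using h.inv.cell w
  by_cases hd : Λ.d w = 0
  · have : rt s w = none := by
      rw [h.rt_eq_none_iff]
      have := h.inv.zero w hd
      rw [vis₂_detach] at this
      tauto
    simp [labelAt, this, hd]
  · have h1 := h.inv.pos w hd
    rw [Ne, ← h.rt_eq_none_iff] at h1
    obtain ⟨u, hu⟩ := Option.ne_none_iff_exists'.1 h1
    simp only [labelAt, hu, hc, ← Λ.cell_iff w q hd hq]
    split_ifs with h2 <;> simp [h2]

/-- Neighbours rejected by the test are roots: they are in a positive layer or, if `q = 0`, are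
visited nodes of layer `0`. So rejected arcs are counted by `scanBound`. -/
theorem Layering.Excess.rt_ne_none {q : ℕ} {s : Mem n₁ n₂} {v : Fin n₁}
    (h : Λ.Excess (q + 1) s v) {w : Fin n₂} (hwv : w ∈ L.out v)
    (hw : ¬(vis₂ s w ≠ Λ.t ∧ Λ.d w = q)) : rt s w ≠ none := by
  rw [Ne, h.rt_eq_none_iff]
  by_cases hd : Λ.d w = 0
  · have h1 := Λ.lam_le v w hwv
    rw [h.lam] at h1
    have h2 := h.inv.zero w hd
    rw [vis₂_detach] at h2
    exact h2.1 (by_contra fun h3 => hw ⟨h3, by omega⟩)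
  · exact h.inv.pos w hd

/-- Marking a root as visited settles its debt. -/
theorem Layering.debt_update {κ : ℕ} {s : Mem n₁ n₂} {w : Fin n₂} (hw : vis₂ s w ≠ Λ.t) :
    Λ.debt κ (Function.update s (.visited₂ w) Λ.t) + ((Λ.child w).map (scanBound L κ)).getD 0 =
      Λ.debt κ s := by
  unfold debt
  rw [← Finset.add_sum_erase _ _ (Finset.mem_univ w), ← Finset.add_sum_erase _ _ (Finset.mem_univ w)]
  simp only [vis₂_update, if_true, if_neg hw, zero_add]
  rw [add_comm]
  congr 1
  refine Finset.sum_congr rfl fun w' hw' => ?_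
  rw [if_neg (Finset.ne_of_mem_erase hw')]

theorem Layering.debt_congr {κ : ℕ} {s s' : Mem n₁ n₂} (h : ∀ w, vis₂ s' w = vis₂ s w) :
    Λ.debt κ s' = Λ.debt κ s := by
  simp [debt, h]

/-- The merger with a `WT₁` branch ends a successful path. -/
theorem Layering.Excess.link {s : Mem n₁ n₂} {v : Fin n₁} {w : Fin n₂} (h : Λ.Excess 1 s v)
    (hwv : w ∈ L.out v) (hr : rt (detach v s) w = none) :
    Λ.Inv 1 (Function.update (Function.update (Function.update (detach v s) (.parent v) (some w))
      (.right w) (some v)) (.visited₂ w) Λ.t) := by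
  have hI := h.inv
  have hv : par (detach v s) v = none := by simp [par_detach]
  have hd : Λ.d w = 0 := by_contra fun hd => hI.pos w hd hr
  have hlam := h.lam
  generalize detach v s = σ at *
  have hM := hI.isMatch
  constructor
  · constructor
    · simpa using hM.out
    · simpa using hM.inn
    · have := hM.par_iff
      simp
      grind
    · simpa using hM.left
    · have := hM.edge
      simp
      grind
  · simpa using hI.cell
  · have := hI.zero
    simp
    grind
  · have := hI.pos
    simp
    grind
  · have := hI.unvisited
    simp
    grind
  · have := hI.visited
    simp [Layering.Closed] at this ⊢
    grind

end Mergers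

end MatchingPseudoflow

namespace MatchingPseudoflow

/-! ### Depth-first searches in the layered network -/

section Searches

variable {n₁ n₂ : ℕ} {L : AdjLists n₁ n₂} {Λ : Layering L} {m κ : ℕ}

/-- The merger with a `WT₂` branch of the next lower layer moves the excess to its child. -/
theorem Layering.Excess.linkLeft {q : ℕ} {s : Mem n₁ n₂} {v u : Fin n₁} {w : Fin n₂}
    (h : Λ.Excess (q + 1) s v) (hwv : w ∈ L.out v) (hw : vis₂ s w ≠ Λ.t) (hd : Λ.d w = q)
    (hr : rt (detach v s) w = some u) :
    Λ.Excess q (Function.update (Function.update (detach v s) (.parent v) (some w))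
      (.left w) (some v)) u := by
  have hI := h.inv
  have hv : par (detach v s) v = none := by simp [par_detach]
  have hlam := h.lam
  rw [← vis₂_detach v] at hw
  generalize detach v s = σ at *
  have hM := hI.isMatch
  have hu := (hM.par_iff u w).2 hr
  have huv : u ≠ v := by rintro rfl; simp [hv] at hu
  -- As `w` is unvisited and below layer `q + 1`, its child is still the one from the beginning of
  -- the stage and so has label `q`. The merger replaces this child by `v`; therefore only the
  -- invariant with parameter `q` survives for the continued search.
  have hwu := hI.unvisited w (by omega) hw
  have hlu := Λ.lam_child w u (by rw [← hwu, hr])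
  refine ⟨?_, by omega, fun x hx => ?_⟩
  · constructor
    · constructor
      · simpa using hM.out
      · simpa using hM.inn
      · have := hM.par_iff
        simp [par_detach, rt_detach, huv, hu]
        grind
      · have := hM.left
        simp [lf_detach, huv, hu]
        grind
      · have := hM.edge
        simp [par_detach]
        grind
    · simpa using hI.cell
    · have := hI.zero
      simp [rt_detach, huv, hu]
      grind
    · have := hI.pos
      simp [rt_detach, huv, hu]
      grind
    · have := hI.unvisited
      simp [rt_detach, huv, hu]
      grind
    · have := hI.visited
      simp [rt_detach, huv, hu, Layering.Closed] at this ⊢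
      grind
  · simp [huv, hu] at hx
    subst hx
    simp [hr, hd]

/-- After a failed search from the child of `w`, the merger from `v` to `w` is reversed. -/
theorem Layering.Excess.reverse {q : ℕ} {s s' s'' : Mem n₁ n₂} {v u : Fin n₁} {w : Fin n₂}
    {l : List (Fin n₂)} (h : Λ.Excess (q + 1) s v) (hw : vis₂ s w ≠ Λ.t)
    (hd : Λ.d w = q) (hr : rt (detach v s) w = some u) (hl : L.out u = l)
    (hS : Λ.Searched q u l (Function.update (Function.update (detach v s) (.parent v) (some w))
      (.left w) (some v)) false s')
    (hs : EqOff VisitedCell s s'') (hv : ∀ w', vis₂ s'' w' = vis₂ s' w') :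
    Λ.Excess (q + 1) (Function.update s'' (.visited₂ w) Λ.t) v := by
  have hI := h.inv
  have hM := hI.isMatch
  have hu := (hM.par_iff u w).2 hr
  have hpv : par (detach v s) v = none := by simp [par_detach]
  have huv : u ≠ v := by rintro rfl; simp [hpv] at hu
  obtain ⟨e1, e2, e3, e4, -, -, e7, e8⟩ := eqOff_visitedCell_iff.1 hs
  obtain ⟨f1, f2, f3, -, -, -, -, -⟩ := eqOff_visitedCell_iff.1 (hS.eqOff rfl)
  have hlu := Λ.lam_child w u (by rw [← hI.unvisited w (by omega) (by simpa using hw), hr])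
  have hlu1 := Λ.one_le_lam u
  have hJ := hS.inv_fail rfl
  have hmono := hS.mono
  simp at hmono
  -- Away from `w`, splitting `u` off after the merger leaves the same children as splitting `v` off
  -- before it.
  have hrt : ∀ w', w' ≠ w → rt (detach u s') w' = rt (detach v s) w' := by
    intro w' hw'
    simp [rt_detach, f1, f2, huv, hu, hw'.symm]
  have hrt' : ∀ w', rt (detach v (Function.update s'' (.visited₂ w) Λ.t)) w' =
      rt (detach v s) w' := by
    intro w'
    simp [rt_detach, e1, e2, e3]
  refine ⟨⟨?_, ?_, ?_, ?_, ?_, ?_⟩, h.lam, ?_⟩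
  · exact hM.congr (by simp [e7]) (by simp [e8]) (by simp [par_detach, e1]) hrt'
      (by simp [lf_detach, e1, e3])
  · intro w'
    simpa [e4] using hI.cell w'
  · intro w' hw'
    have hne : w' ≠ w := by rintro rfl; omega
    have := hJ.zero w' hw'
    rw [hrt w' hne] at this
    simpa [hrt', hne, hv] using this
  · intro w' hw'
    rw [hrt']
    exact hI.pos w' hw'
  · intro w' hw' hw''
    rw [hrt']
    have hne : w' ≠ w := by rintro rfl; simp at hw''
    simp [hne, hv] at hw''
    refine hI.unvisited w' hw' fun hh => hw'' (hmono w' ?_)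
    simpa using hh
  · intro w' u' hw' hu'
    rw [hrt'] at hu'
    rcases eq_or_ne w' w with rfl | hne
    · obtain rfl : u = u' := Option.some.inj (hr.symm.trans hu')
      -- The restored child `u` of `w` keeps its label, and its failed search has exhausted the next
      -- lower layer.
      refine Or.inl ⟨hlu, fun x hx hxd => ?_⟩
      have := hS.closed rfl x (hl ▸ hx) hxd
      simp [hv, this]
    · simp [hne, hv] at hw'
      rw [← hrt w' hne] at hu'
      refine (hJ.visited w' u' (by simpa using hw') hu').imp_left fun hh => ⟨hh.1, fun x hx hxd => ?_⟩
      have := hh.2 x hx hxd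
      simp at this
      simp [hv, this]
  · simpa [e1, e2] using h.holder

/-- After a successful search from the old child of `w`, the merger from `v` to `w` is kept. -/
theorem Layering.Excess.keep {q : ℕ} {s s' : Mem n₁ n₂} {v u : Fin n₁} {w : Fin n₂}
    {l : List (Fin n₂)} (h : Λ.Excess (q + 1) s v) (hw : vis₂ s w ≠ Λ.t)
    (hd : Λ.d w = q) (hr : rt (detach v s) w = some u)
    (hS : Λ.Searched q u l (Function.update (Function.update (detach v s) (.parent v) (some w))
      (.left w) (some v)) true s') :
    Λ.Inv (q + 1) (Function.update s' (.visited₂ w) Λ.t) := by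
  have hI := h.inv
  have hM := hI.isMatch
  have hu := (hM.par_iff u w).2 hr
  have hpv : par (detach v s) v = none := by simp [par_detach]
  have huv : u ≠ v := by rintro rfl; simp [hpv] at hu
  have hq : q ≠ 0 := by
    have := Λ.lam_child w u (by rw [← hI.unvisited w (by omega) (by simpa using hw), hr])
    have := Λ.one_le_lam u
    omega
  have hJ := hS.inv rfl
  have hhigh := hS.high
  have hrth := hS.rt_high rfl
  simp [rt_detach, huv, hu] at hrth
  simp at hhigh
  constructor
  · exact hJ.isMatch.congr (by simp) (by simp) (by simp) (by simp) (by simp)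
  · simpa using hJ.cell
  · have := hJ.zero
    simp
    grind
  · simpa using hJ.pos
  · intro w' hw' hw''
    have hne : w' ≠ w := by rintro rfl; simp at hw''
    simp [hne] at hw'' ⊢
    -- The inner search gives the invariant below layer `q` only. From layer `q` on it altered
    -- neither flags nor children beyond the detachment, so the invariant from before the merger
    -- applies there.
    rcases lt_or_ge (Λ.d w') q with h1 | h1
    · exact hJ.unvisited w' h1 hw''
    · rw [hrth w' h1, if_neg hne.symm]
      have := hI.unvisited w' hw'
      simp [rt_detach, ← hhigh w' h1] at this
      exact this hw''
  · intro w' u' hw' hu'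
    simp at hu'
    rcases eq_or_ne w' w with rfl | hne
    · rw [hrth w' hd.ge] at hu'
      simp at hu'
      subst hu'
      right
      rw [h.lam, hd]
    · simp [hne] at hw'
      refine (hJ.visited w' u' hw' hu').imp_left fun hh => ⟨hh.1, fun x hx hxd => ?_⟩
      have := hh.2 x hx hxd
      simp [this]

theorem Layering.Searched.cons {q : ℕ} {v : Fin n₁} {w : Fin n₂} {l : List (Fin n₂)}
    {s s' : Mem n₁ n₂} {b : Bool} (h : Λ.Searched q v l s b s')
    (hw : Λ.d w + 1 = Λ.lam v → vis₂ s w = Λ.t) : Λ.Searched q v (w :: l) s b s' :=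
  ⟨h.flags, h.high, h.eqOff, h.inv_fail,
    fun hb => List.forall_mem_cons.2 ⟨fun hd => h.mono w (hw hd), h.closed hb⟩,
    h.inv, h.par_iff, h.rt_high, h.eqOff'⟩

/-- A failed and reversed attempt changes visited flags only, so it can be put in front of the
remaining scan. -/
theorem Layering.Searched.of_eqOff {q : ℕ} {v : Fin n₁} {l : List (Fin n₂)}
    {s s₁ s' : Mem n₁ n₂} {b : Bool} (h : Λ.Searched q v l s₁ b s') (hs : EqOff VisitedCell s s₁)
    (hflags : ∀ w, vis₂ s₁ w = Λ.t ∨ vis₂ s₁ w = vis₂ s w)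
    (hhigh : ∀ w, q ≤ Λ.d w → vis₂ s₁ w = vis₂ s w) : Λ.Searched q v l s b s' := by
  obtain ⟨e1, e2, e3, -⟩ := eqOff_visitedCell_iff.1 hs
  refine ⟨fun w => ?_, fun w hw => (h.high w hw).trans (hhigh w hw),
    fun hb => hs.trans (h.eqOff hb), h.inv_fail, h.closed, h.inv, fun hb v' => ?_,
    fun hb w hw => ?_, (hs.mono VisitedCell.mergerCell).trans h.eqOff'⟩
  · rcases h.flags w with h1 | h1
    · exact Or.inl h1
    · rw [h1]
      exact hflags w
  · rw [h.par_iff hb, e1]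
  · rw [h.rt_high hb w hw, rt_detach, rt_detach, e1, e2, e3]

theorem eqOff_merger {s : Mem n₁ n₂} {v : Fin n₁} {w : Fin n₂} (a : Addr n₁ n₂) (x : Val a)
    (ha : MergerCell a) : EqOff MergerCell s
      (Function.update (Function.update (detach v s) (.parent v) (some w)) a x) :=
  ((eqOff_detach v s).update (.parent v) _ trivial).update _ _ ha

/-- Amortization: a call of `next u` costs at most `20 * scanBound L κ u` plus the debt it releases,
and the first part is released in turn when the parent of `u` is marked as visited. What remains is
`20` per scanned root and `18` for the end of the scan. -/
theorem scanOut_spec {q : ℕ} (hq : q ≤ Λ.p) {next : Fin n₁ → Prog n₁ n₂ Bool}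
    (hnext : ∀ u s, Λ.Excess q s u → Ensures (next u) s fun b s' n =>
      Λ.Searched q u (L.out u) s b s' ∧
        n + 20 * Λ.debt κ s' ≤ 20 * scanBound L κ u + 20 * Λ.debt κ s)
    {v : Fin n₁} {x : Option (Fin n₂)} {l : List (Fin n₂)} {s : Mem n₁ n₂}
    (hl : l.Sublist (L.out v)) (hs : Λ.Excess (q + 1) s v) (hx : x = par s v) :
    Ensures (scanOut Λ.t q next x v l) s fun b s' n =>
      Λ.Searched (q + 1) v l s b s' ∧ n + 20 * Λ.debt κ s' ≤
        20 * (l.filter fun w => rt s w ≠ none).length + 18 + 20 * Λ.debt κ s := by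
  induction l generalizing s with
  | nil =>
    simp only [scanOut, ensures_bind, ensures_tick, ensures_ret]
    refine ⟨⟨fun _ => Or.inr rfl, fun _ _ => rfl, fun _ => EqOff.refl _ _, fun _ => hs.inv, ?_, ?_, ?_,
      ?_, EqOff.refl _ _⟩, by omega⟩
    · intro _ w hw
      simp at hw
    all_goals simp
  | cons w l ih =>
    have hwv : w ∈ L.out v := hl.subset (by simp)
    have hl' : l.Sublist (L.out v) := (List.sublist_cons_self w l).trans hl
    simp only [scanOut, ensures_bind, ensures_tick, ensures_isVisited₂]
    refine ensures_getLabel fun k hk => ?_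
    by_cases hc : vis₂ s w ≠ Λ.t ∧ Λ.d w = q
    · obtain ⟨hw, hd⟩ := hc
      rw [if_pos ⟨by simpa using hw, (hs.labelAt_iff hq hw).2 hd⟩]
      simp only [ensures_bind, ensures_getRight]
      cases hr : rt s w with
      | none =>
        have hr' := (hs.rt_eq_none_iff w).1 hr
        -- A target without a child lies in layer `0`, so here the path is complete.
        have hq0 : q = 0 := hd ▸ by_contra fun hd => hs.inv.pos w hd hr'
        subst hq0
        simp only [ensures_bind, hx]
        refine ensures_merger_root hr' fun k' hk' => ?_
        simp only [ensures_write, ensures_ret]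
        refine ⟨⟨?_, ?_, by simp, by simp, by simp, fun _ => hs.link hwv hr', ?_, ?_, ?_⟩, ?_⟩
        · intro w'
          simp
          grind
        · intro w' hw'
          have hne : w' ≠ w := by rintro rfl; omega
          simp [hne]
        · intro _ v'
          simp [par_detach]
          grind
        · intro _ w' hw'
          have hne : w' ≠ w := by rintro rfl; omega
          simp [hne]
        · exact (eqOff_merger (.right w) _ trivial).update (.visited₂ w) _ trivial
        · have h1 := Λ.debt_update (κ := κ) (s := Function.update (Function.update (detach v s)
            (.parent v) (some w)) (.right w) (some v)) (w := w) (by simpa using hw)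
          have h2 := Λ.debt_congr (κ := κ) (s := s) (s' := Function.update (Function.update
            (detach v s) (.parent v) (some w)) (.right w) (some v)) (by simp)
          omega
      | some u =>
        have hpw : par s v ≠ some w := fun hp => by have := (hs.holder w hp).2; omega
        have hr' : rt (detach v s) w = some u := by rw [rt_detach, if_neg hpw, hr]
        have hch := hs.inv.unvisited w (by omega) (by simpa using hw)
        rw [hr'] at hch
        simp only [ensures_bind, hx]
        refine ensures_merger_branch hr' fun k' hk' => ?_
        have h1 := Λ.debt_congr (κ := κ) (s := s) (s' := Function.update (Function.update
            (detach v s) (.parent v) (some w)) (.left w) (some v)) (by simp)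
        refine (hnext u _ (hs.linkLeft hwv hw hd hr')).mono fun b s₂ n hS => ?_
        obtain ⟨hS, hn⟩ := hS
        have hw₂ : vis₂ s₂ w ≠ Λ.t := by
          rw [hS.high w hd.ge]
          simpa using hw
        cases b with
        | true =>
          simp only [if_true, ensures_bind, ensures_write, ensures_ret]
          refine ⟨⟨?_, ?_, by simp, by simp, by simp, fun _ => hs.keep hw hd hr' hS, ?_, ?_, ?_⟩,
            ?_⟩
          · intro w'
            have := hS.flags w'
            simp at this ⊢
            grind
          · intro w' hw'
            have hne : w' ≠ w := by rintro rfl; omega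
            have := hS.high w' (by omega)
            simpa [hne] using this
          · intro _ v'
            have := hS.par_iff rfl v'
            have hpu := (hs.inv.isMatch.par_iff u w).2 hr'
            simp [par_detach] at this hpu ⊢
            rw [this]
            grind
          · intro _ w' hw'
            have hne : w ≠ w' := by rintro rfl; omega
            have := hS.rt_high rfl w' (by omega)
            have hpu := (hs.inv.isMatch.par_iff u w).2 hr'
            simpa [rt_detach, hpu, hne] using this
          · exact ((eqOff_merger (.left w) _ trivial).trans hS.eqOff').update (.visited₂ w) _
              trivial
          · have h2 := Λ.debt_update (κ := κ) hw₂
            rw [← hch] at h2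
            simp at h2 ⊢
            rw [List.filter_cons_of_pos (by simp [hr])]
            simp only [List.length_cons]
            omega
        | false =>
          simp only [Bool.false_eq_true, if_false, ensures_bind, ensures_write]
          have hlw : lf s w = none := by
            have := hs.inv.isMatch.left w
            rwa [lf_detach, if_neg hpw] at this
          refine ensures_backtrack hlw (fun x hx => ⟨(hs.holder x hx).1, ?_⟩) (hS.eqOff rfl)
            fun s₃ n' hn' hs₃ hv₃ => ?_
          · rintro rfl
            exact hpw hx
          have hE : EqOff VisitedCell s (Function.update s₃ (.visited₂ w) Λ.t) :=
            hs₃.update (.visited₂ w) _ trivial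
          obtain ⟨e1, e2, -⟩ := eqOff_visitedCell_iff.1 hE
          have hvw : vis₂ (Function.update s₃ (.visited₂ w) Λ.t) w = Λ.t := by simp
          rw [← hx]
          refine (ih hl' (hs.reverse hw hd hr' rfl hS hs₃ hv₃) (by rw [hx, e1])).mono
            fun b s' n'' hT => ?_
          -- The bound for the rest of the list counts roots in the memory after the reversal, which
          -- has the same roots as `s`.
          have hfun : rt (Function.update s₃ (.visited₂ w) Λ.t) = rt s := funext e2
          rw [hfun] at hT
          refine ⟨(hT.1.cons fun _ => hvw).of_eqOff hE (fun w' => ?_) fun w' hw' => ?_, ?_⟩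
          · have := hS.flags w'
            simp [hv₃] at this ⊢
            grind
          · have hne : w' ≠ w := by rintro rfl; omega
            have := hS.high w' (by omega)
            simpa [hne, hv₃] using this
          -- Marking `w` releases exactly the scan bound of its child `u`, which pays for the failed
          -- search from `u`.
          · have h2 := Λ.debt_update (κ := κ) (s := s₃) (w := w) (by rwa [hv₃])
            have h3 := Λ.debt_congr (κ := κ) hv₃
            have := hT.2
            rw [← hch] at h2
            simp at h2
            rw [List.filter_cons_of_pos (by simp [hr])]
            simp only [List.length_cons]
            omega
    · rw [if_neg (by
        rintro ⟨h1, h2⟩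
        have h1 : vis₂ s w ≠ Λ.t := by simpa using h1
        exact hc ⟨h1, (hs.labelAt_iff hq h1).1 h2⟩)]
      refine (ih hl' hs hx).mono fun b s' n hS => ⟨hS.1.cons fun hd => ?_, ?_⟩
      · rw [hs.lam] at hd
        exact by_contra fun hw => hc ⟨hw, by omega⟩
      · rw [List.filter_cons_of_pos (by simpa using hs.rt_ne_none hwv hc)]
        have := hS.2
        simp only [List.length_cons]
        omega

theorem search_spec (hL : L.Sizes m κ) {q : ℕ} (hq : q ≤ Λ.p + 1) {v : Fin n₁} {s : Mem n₁ n₂}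
    (hs : Λ.Excess q s v) : Ensures (search Λ.t q v) s fun b s' n =>
      Λ.Searched q v (L.out v) s b s' ∧
        n + 20 * Λ.debt κ s' ≤ 20 * scanBound L κ v + 20 * Λ.debt κ s := by
  induction q generalizing v s with
  | zero =>
    have := hs.lam
    have := Λ.one_le_lam v
    omega
  | succ q ih =>
    simp only [search, ensures_bind, ensures_getParent, ensures_getOut]
    have ho : outAt s v = L.out v := by simpa using hs.inv.isMatch.out v
    rw [ho]
    refine (scanOut_spec (by omega) (fun u s hs => ih (by omega) hs) (List.Sublist.refl _) hs
      rfl).mono fun b s' n hS => ⟨hS.1, ?_⟩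
    have h1 := length_filter_roots_le hs.inv.isMatch hL (List.Sublist.refl (L.out v))
    -- With the excess at `v` the memory need not be a matching, so the roots are counted after
    -- detaching `v`.
    have h2 : ((L.out v).filter fun w => rt s w ≠ none) =
        (L.out v).filter fun w => rt (detach v s) w ≠ none := by
      simp only [Ne, hs.rt_eq_none_iff]
    rw [h2] at hS
    have := hS.2
    omega

end Searches

end MatchingPseudoflow

namespace MatchingPseudoflow

/-! ### The mergers of one stage: counting searches and the new lower bound -/

section StageMergers

variable {n₁ n₂ : ℕ} {L : AdjLists n₁ n₂} {Λ : Layering L} {m κ : ℕ}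

/-- The cells that the mergers of a stage write. -/
def StageCell : Addr n₁ n₂ → Prop
  | .out _ => False
  | .inn _ => False
  | .label _ => False
  | .ptr _ => False
  | _ => True

theorem MergerCell.stageCell (a : Addr n₁ n₂) (h : MergerCell a) : StageCell a := by
  cases a <;> simp_all [StageCell, MergerCell]

/-- The nodes of `V₁` from which searches were started in the stage. -/
def Layering.searched (Λ : Layering L) (s : Mem n₁ n₂) : Finset (Fin n₁) :=
  Finset.univ.filter fun v => vis₁ s v = Λ.t

/-- The visited roots that were roots of `WT₂` branches at the beginning of the stage. -/
def Layering.visitedRoots (Λ : Layering L) (s : Mem n₁ n₂) : Finset (Fin n₂) :=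
  Finset.univ.filter fun w => vis₂ s w = Λ.t ∧ Λ.child w ≠ none

/-- The matched nodes of `V₁` and those from which searches were started. -/
def Layering.touched (Λ : Layering L) (s : Mem n₁ n₂) : Finset (Fin n₁) :=
  Finset.univ.filter fun v => par s v ≠ none ∨ vis₁ s v = Λ.t

/-- The invariant between two searches that start at `ST₁` branches, in a stage that began with
`k` matched nodes. -/
structure Layering.Between (Λ : Layering L) (k : ℕ) (s : Mem n₁ n₂) : Prop where
  inv : Λ.Inv (Λ.p + 2) s
  lam : ∀ v, par s v = none → Λ.lam v = Λ.p + 1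
  closed : ∀ v, vis₁ s v = Λ.t → par s v = none → Λ.Closed s v (L.out v)
  count : (Λ.searched s).card + k ≤ msize s + (Λ.visitedRoots s).card

/-- The memory changes monotonically within a stage. -/
structure Layering.Later (Λ : Layering L) (s s' : Mem n₁ n₂) : Prop where
  flags₂ : ∀ w, vis₂ s' w = Λ.t ∨ vis₂ s' w = vis₂ s w
  flags₁ : ∀ v, vis₁ s' v = Λ.t ∨ vis₁ s' v = vis₁ s v
  par : ∀ v, par s v ≠ none → par s' v ≠ none
  eqOff : EqOff StageCell s s'
  progress : (∀ v, MatchingPseudoflow.par s' v = MatchingPseudoflow.par s v) ∨ msize s < msize s'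

theorem Layering.Later.vis₂ {s s' : Mem n₁ n₂} (h : Λ.Later s s') (w : Fin n₂)
    (hw : vis₂ s w = Λ.t) : MatchingPseudoflow.vis₂ s' w = Λ.t :=
  (h.flags₂ w).elim id fun hh => hh.trans hw

theorem Layering.Later.vis₁ {s s' : Mem n₁ n₂} (h : Λ.Later s s') (v : Fin n₁)
    (hv : vis₁ s v = Λ.t) : MatchingPseudoflow.vis₁ s' v = Λ.t :=
  (h.flags₁ v).elim id fun hh => hh.trans hv

theorem msize_mono {s s' : Mem n₁ n₂} (h : ∀ v, par s v ≠ none → par s' v ≠ none) :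
    msize s ≤ msize s' :=
  Finset.card_le_card fun v hv => by
    simp only [Finset.mem_filter, Finset.mem_univ, true_and] at hv ⊢
    exact h v hv

theorem Layering.Later.refl (s : Mem n₁ n₂) : Λ.Later s s :=
  ⟨fun _ => Or.inr rfl, fun _ => Or.inr rfl, fun _ => id, EqOff.refl _ _, Or.inl fun _ => rfl⟩

theorem Layering.Later.trans {s s' s'' : Mem n₁ n₂} (h : Λ.Later s s') (h' : Λ.Later s' s'') :
    Λ.Later s s'' := by
  refine ⟨fun w => (h'.flags₂ w).elim Or.inl fun hh => hh ▸ h.flags₂ w,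
    fun v => (h'.flags₁ v).elim Or.inl fun hh => hh ▸ h.flags₁ v,
    fun v hv => h'.par v (h.par v hv), h.eqOff.trans h'.eqOff, ?_⟩
  have h1 := msize_mono h.par
  have h2 := msize_mono h'.par
  rcases h.progress with h3 | h3
  · rcases h'.progress with h4 | h4
    · exact Or.inl fun v => (h4 v).trans (h3 v)
    · right; omega
  · right; omega

theorem Layering.Inv.update_visited₁ {q : ℕ} {s : Mem n₁ n₂} (h : Λ.Inv q s) (v : Fin n₁) (k : ℕ) :
    Λ.Inv q (Function.update s (.visited₁ v) k) := by
  constructor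
  · exact h.isMatch.congr (by simp) (by simp) (by simp) (by simp) (by simp)
  · simpa using h.cell
  · simpa using h.zero
  · simpa using h.pos
  · simpa using h.unvisited
  · have := h.visited
    simpa [Layering.Closed] using this

theorem detach_of_par_eq_none {v : Fin n₁} {s : Mem n₁ n₂} (h : par s v = none) :
    detach v s = s := by
  simp [detach, h]

theorem Layering.Between.excess {k : ℕ} {s : Mem n₁ n₂} (h : Λ.Between k s) {v : Fin n₁}
    (hv : par s v = none) : Λ.Excess (Λ.p + 1) s v := by
  refine ⟨?_, h.lam v hv, by simp [hv]⟩
  rw [detach_of_par_eq_none hv]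
  exact h.inv.mono (by omega)

theorem card_filter_insert {α : Type*} [Fintype α] [DecidableEq α] {q r : α → Prop}
    [DecidablePred q] [DecidablePred r] {a : α} (ha : ¬ q a) (h : ∀ b, r b ↔ q b ∨ b = a) :
    (Finset.univ.filter r).card = (Finset.univ.filter q).card + 1 := by
  rw [← Finset.card_insert_of_notMem (a := a) (by simpa using ha)]
  congr 1
  ext b
  simp [h, or_comm]

/-- Every search from a free node pays for itself in `count`: success adds a matched node, and
failure leaves `w`, previously unvisited, visited. -/
theorem Layering.Between.searched {k : ℕ} {s s' : Mem n₁ n₂} (h : Λ.Between k s) {v : Fin n₁}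
    {w : Fin n₂} {b : Bool} (hv : par s v = none) (hv' : vis₁ s v ≠ Λ.t) (hw : vis₂ s w ≠ Λ.t)
    (hd : Λ.d w = Λ.p) (hp : 1 ≤ Λ.p) (hwv : w ∈ L.out v)
    (hS : Λ.Searched (Λ.p + 1) v (L.out v) s b s') :
    Λ.Between k (Function.update s' (.visited₁ v) Λ.t) ∧
      Λ.Later s (Function.update s' (.visited₁ v) Λ.t) := by
  have hvis : ∀ v', vis₁ s' v' = vis₁ s v' := fun v' => hS.eqOff' (.visited₁ v') id
  have hsea : (Λ.searched (Function.update s' (.visited₁ v) Λ.t)).card =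
      (Λ.searched s).card + 1 := by
    refine card_filter_insert hv' fun v' => ?_
    simp [hvis]
    tauto
  have hvr : Λ.visitedRoots s ⊆ Λ.visitedRoots s' := by
    intro w' hw'
    simp [visitedRoots] at hw' ⊢
    exact ⟨hS.mono w' hw'.1, hw'.2⟩
  have hvr' : Λ.visitedRoots (Function.update s' (.visited₁ v) Λ.t) = Λ.visitedRoots s' := by
    simp [visitedRoots]
  have hms : msize (Function.update s' (.visited₁ v) Λ.t) = msize s' := by simp [msize]
  have hE : EqOff StageCell s (Function.update s' (.visited₁ v) Λ.t) :=
    (hS.eqOff'.mono MergerCell.stageCell).update (.visited₁ v) _ trivial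
  cases b with
  | true =>
    have hI := hS.inv rfl
    have hpar := hS.par_iff rfl
    have hm : msize s' = msize s + 1 := card_filter_insert (a := v) (by simpa using hv) hpar
    have hrt := hS.rt_high rfl
    rw [detach_of_par_eq_none hv] at hrt
    refine ⟨⟨Inv.update_visited₁ ⟨hI.isMatch, hI.cell, hI.zero, hI.pos, ?_, hI.visited⟩ _ _, ?_,
      ?_, ?_⟩, ?_, ?_, ?_, hE, Or.inr (by omega)⟩
    -- A search from label `p + 1` does not affect the top layer `p + 1`, so the parameter of the
    -- invariant returns to `p + 2`, which means all layers.
    · intro w' hw' hw''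
      rcases Nat.lt_or_ge (Λ.d w') (Λ.p + 1) with h1 | h1
      · exact hI.unvisited w' h1 hw''
      · rw [hrt w' h1]
        exact h.inv.unvisited w' hw' (by rwa [← hS.high w' h1])
    · intro v' hv'
      simp at hv'
      exact h.lam v' (by_contra fun hn => (hpar v').2 (Or.inl hn) hv')
    · intro v' h1 h2
      simp at h2
      have h3 : v' ≠ v := by rintro rfl; exact (hpar v').2 (Or.inr rfl) h2
      simp [h3, hvis] at h1
      intro x hx hxd
      have := h.closed v' h1 (by_contra fun hn => (hpar v').2 (Or.inl hn) h2) x hx hxd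
      simpa using hS.mono x this
    · have := Finset.card_le_card hvr
      have := h.count
      rw [hsea, hvr', hms]
      omega
    · simpa using hS.flags
    · intro v'
      simp [hvis]
      grind
    · intro v' h1
      simpa using (hpar v').2 (Or.inl h1)
  | false =>
    obtain ⟨e1, e2, -⟩ := eqOff_visitedCell_iff.1 (hS.eqOff rfl)
    have hI := hS.inv_fail rfl
    rw [detach_of_par_eq_none (by rw [e1, hv])] at hI
    have hclosed := hS.closed rfl
    -- The failed search exhausted layer `p` among the neighbours of `v`, and `w` is one of them.
    have hw' : vis₂ s' w = Λ.t := hclosed w hwv (by rw [h.lam v hv, hd])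
    have hcw : Λ.child w ≠ none := by
      rw [← h.inv.unvisited w (by omega) hw]
      exact h.inv.pos w (by omega)
    refine ⟨⟨Inv.update_visited₁ ⟨hI.isMatch, hI.cell, hI.zero, hI.pos, ?_, hI.visited⟩ _ _, ?_,
      ?_, ?_⟩, ?_, ?_, ?_, hE, Or.inl ?_⟩
    · intro w' hw' hw''
      rw [e2]
      exact h.inv.unvisited w' hw' fun hn => hw'' (hS.mono w' hn)
    · simpa [e1] using h.lam
    · intro v' h1 h2
      simp [e1] at h2
      rcases eq_or_ne v' v with rfl | h3
      · intro x hx hxd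
        simpa using hclosed x hx hxd
      · simp [h3, hvis] at h1
        intro x hx hxd
        simpa using hS.mono x (h.closed v' h1 h2 x hx hxd)
    · have h1 : (Λ.visitedRoots s).card < (Λ.visitedRoots s').card := by
        refine Finset.card_lt_card (Finset.ssubset_iff_subset_ne.2 ⟨hvr, fun he => hw ?_⟩)
        have : w ∈ Λ.visitedRoots s' := by simp [visitedRoots, hw', hcw]
        rw [← he] at this
        simp [visitedRoots] at this
        exact this.1
      have := h.count
      have h2 : msize s' = msize s := by simp [msize, e1]
      rw [hsea, hvr', hms]
      omega
    · simpa using hS.flags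
    · intro v'
      simp [hvis]
      grind
    · intro v' h1
      simpa [e1] using h1
    · simpa using e1

theorem sum_searched_update {s : Mem n₁ n₂} {v : Fin n₁} (hv : vis₁ s v ≠ Λ.t) :
    ∑ v' ∈ Λ.searched (Function.update s (.visited₁ v) Λ.t), scanBound L κ v' =
      scanBound L κ v + ∑ v' ∈ Λ.searched s, scanBound L κ v' := by
  rw [← Finset.sum_insert (by simpa [Layering.searched] using hv)]
  congr 1
  ext v'
  simp [Layering.searched]
  tauto

/-- The scan stops at the latest when `w` is visited; until then every tail it passes is matched or
has been searched from, hence belongs to `touched`. The searches themselves are charged to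
`searched` and to the debt. -/
theorem startFrom_spec (hL : L.Sizes m κ) {k : ℕ} {w : Fin n₂} (hd : Λ.d w = Λ.p) (hp : 1 ≤ Λ.p)
    {l : List (Fin n₁)} {s : Mem n₁ n₂} (hl : l.Sublist (L.inn w)) (hs : Λ.Between k s) :
    Ensures (startFrom Λ.t Λ.p w l) s fun _ s' n => Λ.Between k s' ∧ Λ.Later s s' ∧
      (vis₂ s' w = Λ.t ∨ ∀ v ∈ l, par s' v = none → vis₁ s' v = Λ.t) ∧
      n + 20 * Λ.debt κ s' + 20 * ∑ v ∈ Λ.searched s, scanBound L κ v ≤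
        10 * (l.filter (· ∈ Λ.touched s')).length + 10 + 20 * Λ.debt κ s +
          20 * ∑ v ∈ Λ.searched s', scanBound L κ v := by
  induction l generalizing s with
  | nil =>
    simp only [startFrom, ensures_tick]
    exact ⟨hs, Layering.Later.refl s, by simp, by omega⟩
  | cons v l ih =>
    have hl' : l.Sublist (L.inn w) := (List.sublist_cons_self v l).trans hl
    have hwv : w ∈ L.out v := (hL.mem_inn v w).1 (hl.subset (by simp))
    simp only [startFrom, ensures_bind, ensures_tick, ensures_isVisited₂]
    by_cases hw : vis₂ s w = Λ.t
    · simp only [hw, decide_true, if_true, ensures_ret]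
      exact ⟨hs, Layering.Later.refl s, Or.inl trivial, by omega⟩
    · simp only [hw, decide_false, Bool.false_eq_true, if_false, ensures_bind, ensures_getParent,
        ensures_isVisited₁]
      by_cases hv : par s v = none ∧ vis₁ s v ≠ Λ.t
      · rw [if_pos (by simpa using hv)]
        simp only [ensures_bind]
        refine (search_spec hL le_rfl (hs.excess hv.1)).mono fun b s₁ n hS => ?_
        obtain ⟨hS, hn⟩ := hS
        simp only [ensures_write]
        obtain ⟨hs₂, hl₂⟩ := hs.searched hv.1 hv.2 hw hd hp hwv hS
        refine (ih hl' hs₂).mono fun _ s' n' h => ?_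
        obtain ⟨h1, h2, h3, h4⟩ := h
        refine ⟨h1, hl₂.trans h2, ?_, ?_⟩
        · refine h3.imp_right fun h3 => List.forall_mem_cons.2 ⟨fun _ => h2.vis₁ v (by simp), h3⟩
        · have h5 : v ∈ Λ.touched s' := by
            simp [Layering.touched, h2.vis₁ v]
          have h6 : vis₁ s₁ v ≠ Λ.t := by
            have : vis₁ s₁ v = vis₁ s v := hS.eqOff' (.visited₁ v) id
            rw [this]
            exact hv.2
          have h7 : Λ.searched s₁ = Λ.searched s := by
            have : vis₁ s₁ = vis₁ s := funext fun v => hS.eqOff' (.visited₁ v) id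
            simp [Layering.searched, this]
          rw [sum_searched_update h6, h7] at h4
          have h8 := Λ.debt_congr (κ := κ) (s := s₁)
            (s' := Function.update s₁ (.visited₁ v) Λ.t) (by simp)
          rw [List.filter_cons_of_pos (by simpa using h5)]
          simp only [List.length_cons]
          omega
      · rw [if_neg (by simpa using hv)]
        refine (ih hl' hs).mono fun _ s' n' h => ?_
        obtain ⟨h1, h2, h3, h4⟩ := h
        have h5 : par s' v ≠ none ∨ vis₁ s' v = Λ.t := by
          by_cases hp : par s v = none
          · exact Or.inr (h2.vis₁ v (by_contra fun hn => hv ⟨hp, hn⟩))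
          · exact Or.inl (h2.par v hp)
        refine ⟨h1, h2, ?_, ?_⟩
        · refine h3.imp_right fun h3 => List.forall_mem_cons.2 ⟨fun hn => ?_, h3⟩
          exact h5.resolve_left (by simp [hn])
        · rw [List.filter_cons_of_pos (by simpa [Layering.touched] using h5)]
          simp only [List.length_cons]
          omega

/-- By `count`, searches are bounded by matched nodes plus visited roots, and each of these numbers
is at most `κ`. -/
theorem Layering.Between.card_searched_le (hL : L.Sizes m κ) {k : ℕ} {s : Mem n₁ n₂}
    (h : Λ.Between k s) (hc : ∀ w, Λ.child w ≠ none → Λ.d w ≠ 0) :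
    (Λ.searched s).card ≤ 2 * κ := by
  have h1 := h.count
  have h2 := h.inv.isMatch.msize_le hL
  have h3 : (Λ.visitedRoots s).card ≤ msize s := by
    rw [← h.inv.isMatch.card_roots]
    refine Finset.card_le_card fun w hw => ?_
    simp only [Layering.visitedRoots, Finset.mem_filter, Finset.mem_univ, true_and] at hw
    exact mem_roots.2 (h.inv.pos w (hc w hw.2))
  omega

theorem Layering.Between.card_touched_le (hL : L.Sizes m κ) {k : ℕ} {s : Mem n₁ n₂}
    (h : Λ.Between k s) (hc : ∀ w, Λ.child w ≠ none → Λ.d w ≠ 0) :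
    (Λ.touched s).card ≤ 3 * κ := by
  have h1 := h.card_searched_le hL hc
  have h2 := h.inv.isMatch.msize_le hL
  have h3 : (Λ.touched s).card ≤ msize s + (Λ.searched s).card := by
    unfold Layering.touched msize Layering.searched
    rw [Finset.filter_or]
    exact Finset.card_union_le _ _
  omega

theorem stageMergers_spec (hL : L.Sizes m κ) {k : ℕ} (hc : ∀ w, Λ.child w ≠ none → Λ.d w ≠ 0)
    (hp : 1 ≤ Λ.p) {ws : List (Fin n₂)} {s : Mem n₁ n₂} (hws : ∀ w ∈ ws, Λ.d w = Λ.p)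
    (hs : Λ.Between k s) :
    Ensures (stageMergers Λ.t Λ.p ws) s fun _ s' n => Λ.Between k s' ∧ Λ.Later s s' ∧
      (∀ w ∈ ws, ∀ v, w ∈ L.out v → par s' v = none → vis₂ s' w = Λ.t) ∧
      n + 20 * Λ.debt κ s' + 20 * ∑ v ∈ Λ.searched s, scanBound L κ v ≤
        12 * (ws.map fun w => min (L.inn w).length (3 * κ) + 1).sum + 1 + 20 * Λ.debt κ s +
          20 * ∑ v ∈ Λ.searched s', scanBound L κ v := by
  induction ws generalizing s with
  | nil =>
    simp only [stageMergers, ensures_tick]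
    exact ⟨hs, Layering.Later.refl s, by simp, by simp⟩
  | cons w ws ih =>
    simp only [stageMergers, ensures_bind, ensures_tick, ensures_getInn, hs.inv.isMatch.inn]
    have hd := hws w (by simp)
    refine (startFrom_spec hL hd hp (List.Sublist.refl _) hs).mono fun _ s₁ n h => ?_
    obtain ⟨h1, h2, h3, h4⟩ := h
    refine (ih (fun w hw => hws w (by simp [hw])) h1).mono fun _ s' n' h => ?_
    obtain ⟨h5, h6, h7, h8⟩ := h
    refine ⟨h5, h2.trans h6, List.forall_mem_cons.2 ⟨fun v hv hn => h6.vis₂ w ?_, h7⟩, ?_⟩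
    · rcases h3 with h3 | h3
      · exact h3
      -- A node that is free at the end was free all along. If all free tails at `w` were searched
      -- from, `v` was too, and its failure forces `w` to be visited.
      · have hn' : par s₁ v = none := by_contra fun hh => h6.par v hh hn
        exact h1.closed v (h3 v ((hL.mem_inn v w).2 hv) hn') hn' w hv (by rw [h1.lam v hn', hd])
    · have h9 := length_filter_le hL (List.Sublist.refl (L.inn w)) (Λ.touched s₁)
      have h10 := h1.card_touched_le hL hc
      simp only [List.map_cons, List.sum_cons]
      omega

/-- After the mergers of a stage, incrementing the labels of the visited roots gives lower bounds
for the new labels. -/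
theorem Layering.Between.lowerBound {k : ℕ} {s : Mem n₁ n₂} (hs : Λ.Between k s)
    (hd : ∀ w, Λ.d w ≤ Λ.p + 1)
    (h : ∀ w v, Λ.d w = Λ.p → w ∈ L.out v → par s v = none → vis₂ s w = Λ.t) :
    LowerBound L s (fun w => Λ.d w + if vis₂ s w = Λ.t then 1 else 0) (Λ.p + 1) := by
  constructor
  · intro w hw
    have h1 : Λ.d w = 0 := by_contra fun hn => hs.inv.pos w hn hw
    have h2 := hs.inv.zero w h1
    have h3 : vis₂ s w ≠ Λ.t := fun hn => h2.1 hn hw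
    simp [h1, h3]
  · intro v x w hv hw
    have h1 := Λ.lam_le v w hw
    have h2 := (hs.inv.isMatch.par_iff v x).1 hv
    by_cases h3 : vis₂ s x = Λ.t
    · simp only [h3, if_true]
      -- If `v` has the label of `x`, a tight neighbour `w` is visited and both labels increase. If
      -- `v` came from the next layer, the old inequality already had the necessary slack.
      rcases hs.inv.visited x v h3 h2 with ⟨h4, h5⟩ | h4
      · have h6 := h5 w hw
        split_ifs <;> grind
      · split_ifs <;> omega
    · have h4 := hs.inv.unvisited x (by have := hd x; omega) h3
      have h5 := Λ.lam_child x v (by rw [← h4, h2])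
      simp only [h3, if_false]
      split_ifs <;> omega
  · intro v w hv hw
    have h1 := Λ.lam_le v w hw
    rw [hs.lam v hv] at h1
    have h2 := h w v
    split_ifs <;> grind

end StageMergers

end MatchingPseudoflow

namespace MatchingPseudoflow

/-! ### Greedy initialization and the first layer -/

section Initialization

variable {n₁ n₂ : ℕ} {L : AdjLists n₁ n₂} {m κ : ℕ}

/-- The nodes in the list of `v` before its pointer are roots of `WT₂` branches. -/
def PtrOK (L : AdjLists n₁ n₂) (s : Mem n₁ n₂) (v : Fin n₁) : Prop :=
  ∃ l, L.out v = l ++ ptrAt s v ∧ ∀ w ∈ l, rt s w ≠ none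

theorem seekWT₁_spec (v : Fin n₁) (l : List (Fin n₂)) (s : Mem n₁ n₂) :
    Ensures (seekWT₁ v l) s fun r s' n => ∃ l₁ l₂, l = l₁ ++ l₂ ∧ (∀ w ∈ l₁, rt s w ≠ none) ∧
      r = l₂.head? ∧ (∀ w, r = some w → rt s w = none) ∧ s' = Function.update s (.ptr v) l₂ ∧
        n ≤ 2 * (l.filter fun w => rt s w ≠ none).length + 3 := by
  induction l with
  | nil =>
    simp only [seekWT₁, ensures_bind, ensures_write, ensures_ret]
    exact ⟨[], [], by simp⟩
  | cons w l ih =>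
    simp only [seekWT₁, ensures_bind, ensures_tick, ensures_getRight]
    cases hr : rt s w with
    | none =>
      simp only [ensures_bind, ensures_write, ensures_ret]
      exact ⟨[], w :: l, by simp [hr]⟩
    | some u =>
      refine ih.mono fun r s' n => ?_
      rintro ⟨l₁, l₂, rfl, h1, h2, h3, h4, h5⟩
      refine ⟨w :: l₁, l₂, rfl, List.forall_mem_cons.2 ⟨by simp [hr], h1⟩, h2, h3, h4, ?_⟩
      rw [List.filter_cons_of_pos (by simp [hr])]
      simp only [List.length_cons]
      omega

theorem IsMatch.update_ptr {s : Mem n₁ n₂} (h : IsMatch L s) (v : Fin n₁) (l : List (Fin n₂)) :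
    IsMatch L (Function.update s (.ptr v) l) :=
  h.congr (by simp) (by simp) (by simp) (by simp) (by simp)

theorem IsMatch.link {s : Mem n₁ n₂} (h : IsMatch L s) {v : Fin n₁} {w : Fin n₂}
    (hv : par s v = none) (hw : rt s w = none) (hwv : w ∈ L.out v) :
    IsMatch L (Function.update (Function.update s (.parent v) (some w)) (.right w) (some v)) := by
  constructor
  · simpa using h.out
  · simpa using h.inn
  · have := h.par_iff
    simp
    grind
  · simpa using h.left
  · have := h.edge
    simp
    grind

/-- The outcome of the greedy initialization along the list `vs`. -/
structure GreedyDone (L : AdjLists n₁ n₂) (vs : List (Fin n₁)) (s : Mem n₁ n₂)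
    (c : List (Fin n₁)) (s' : Mem n₁ n₂) : Prop where
  isMatch : IsMatch L s'
  nodup : c.Nodup
  mem_iff : ∀ v, v ∈ c ↔ v ∈ vs ∧ par s' v ≠ none
  ptrOK : ∀ v ∈ c, PtrOK L s' v
  blocked : ∀ v ∈ vs, par s' v = none → ∀ w ∈ L.out v, rt s' w ≠ none
  rt_mono : ∀ w, rt s w ≠ none → rt s' w ≠ none
  par_eq : ∀ v, v ∉ vs → par s' v = par s v
  ptr_eq : ∀ v, v ∉ vs → ptrAt s' v = ptrAt s v
  lab_eq : ∀ w, lab s' w = lab s w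
  vis₁_eq : ∀ v, vis₁ s' v = vis₁ s v
  vis₂_eq : ∀ w, vis₂ s' w = vis₂ s w

/-- Roots never lose their status here, so a node left free because all its neighbours were matched
stays blocked, and the saved pointers remain valid. -/
theorem greedy_spec (hL : L.Sizes m κ) {vs : List (Fin n₁)} {s : Mem n₁ n₂} (hs : IsMatch L s)
    (hvs : vs.Nodup) (hpar : ∀ v ∈ vs, par s v = none) :
    Ensures (greedy vs) s fun c s' n => GreedyDone L vs s c s' ∧
      n ≤ 13 * (vs.map (scanBound L κ)).sum + 1 := by
  induction vs generalizing s with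
  | nil =>
    simp only [greedy, ensures_bind, ensures_tick, ensures_ret]
    exact ⟨⟨hs, by simp, by simp, by simp, by simp, fun _ => id, fun _ _ => rfl, fun _ _ => rfl,
      fun _ => rfl, fun _ => rfl, fun _ => rfl⟩, by simp⟩
  | cons v vs ih =>
    obtain ⟨hv, hvs⟩ := List.nodup_cons.1 hvs
    obtain ⟨hpv, hpar⟩ := List.forall_mem_cons.1 hpar
    simp only [greedy, ensures_bind, ensures_tick, ensures_getOut, hs.out]
    refine (seekWT₁_spec v _ s).mono fun r s₁ n => ?_
    rintro ⟨l₁, l₂, h1, h2, h3, h4, rfl, h5⟩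
    have hlen := length_filter_roots_le hs hL (List.Sublist.refl (L.out v))
    cases r with
    | none =>
      have hl₂ : l₂ = [] := by simpa using h3.symm
      subst hl₂
      refine (ih (hs.update_ptr v []) hvs (by simpa using hpar)).mono fun c s' n' => ?_
      rintro ⟨h, hn'⟩
      refine ⟨⟨h.isMatch, h.nodup, ?_, h.ptrOK, ?_, by simpa using h.rt_mono, ?_, ?_,
        by simpa using h.lab_eq, by simpa using h.vis₁_eq, by simpa using h.vis₂_eq⟩, ?_⟩
      · intro v'
        rw [h.mem_iff]
        rcases eq_or_ne v' v with rfl | hne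
        · have := h.par_eq v' hv
          simp at this
          simp [this, hpv]
        · simp [hne]
      · refine List.forall_mem_cons.2 ⟨fun _ w hw => h.rt_mono w ?_, h.blocked⟩
        rw [h1, List.append_nil] at hw
        simpa using h2 w hw
      · intro v' hv'
        have := h.par_eq v' (fun hh => hv' (by simp [hh]))
        simpa using this
      · intro v' hv'
        have := h.ptr_eq v' (fun hh => hv' (by simp [hh]))
        have hne : v' ≠ v := by rintro rfl; simp at hv'
        simpa [hne] using this
      · simp only [List.map_cons, List.sum_cons]
        omega
    | some w =>
      obtain ⟨l₂', rfl⟩ : ∃ l₂', l₂ = w :: l₂' := by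
        cases l₂ with
        | nil => simp at h3
        | cons x l => simp at h3; exact ⟨l, by rw [h3]⟩
      have hw := h4 w rfl
      have hwv : w ∈ L.out v := by rw [h1]; simp
      simp only [ensures_bind]
      set s₁ := Function.update s (.ptr v) (w :: l₂') with hs₁
      have hpv₁ : par s₁ v = none := by simpa [hs₁] using hpv
      have hw₁ : rt s₁ w = none := by simpa [hs₁] using hw
      rw [← hpv₁]
      refine ensures_merger_root (by rw [detach_of_par_eq_none hpv₁, hw₁]) fun k hk => ?_
      rw [detach_of_par_eq_none hpv₁]
      have hM := (hs.update_ptr v (w :: l₂')).link hpv₁ hw₁ hwv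
      refine (ih hM hvs ?_).mono fun c s' n' => ?_
      · intro v' hv'
        have hne : v' ≠ v := by rintro rfl; exact hv hv'
        simpa [hne] using hpar v' hv'
      rintro ⟨h, hn'⟩
      simp only [ensures_ret]
      have hpv' := h.par_eq v hv
      simp at hpv'
      have hrt : ∀ w', w' = w ∨ rt s w' ≠ none → rt s' w' ≠ none := by
        intro w' hw'
        apply h.rt_mono
        rcases eq_or_ne w' w with rfl | hne
        · simp
        · simpa [hne, hs₁] using hw'
      have hptr := h.ptr_eq v hv
      simp at hptr
      refine ⟨⟨h.isMatch, List.nodup_cons.2 ⟨fun hh => hv ((h.mem_iff v).1 hh).1, h.nodup⟩, ?_,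
        List.forall_mem_cons.2 ⟨⟨l₁, by rw [hptr, h1], fun w' hw' => hrt w' (Or.inr (h2 w' hw'))⟩,
          h.ptrOK⟩, ?_, fun w' hw' => hrt w' (Or.inr hw'), ?_, ?_,
        by simpa [hs₁] using h.lab_eq, by simpa [hs₁] using h.vis₁_eq,
        by simpa [hs₁] using h.vis₂_eq⟩, ?_⟩
      · intro v'
        rw [List.mem_cons, h.mem_iff]
        rcases eq_or_ne v' v with rfl | hne
        · simp [hpv']
        · simp [hne]
      · refine List.forall_mem_cons.2 ⟨fun hn => ?_, h.blocked⟩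
        simp [hpv'] at hn
      · intro v' hv'
        have := h.par_eq v' (fun hh => hv' (by simp [hh]))
        have hne : v' ≠ v := by rintro rfl; simp at hv'
        simpa [hne, hs₁] using this
      · intro v' hv'
        have := h.ptr_eq v' (fun hh => hv' (by simp [hh]))
        have hne : v' ≠ v := by rintro rfl; simp at hv'
        simpa [hne, hs₁] using this
      · simp only [List.map_cons, List.sum_cons]
        omega

/-- The outcome of the generation of the `1`-layer from the candidates `cand`. -/
structure LayerOneDone (L : AdjLists n₁ n₂) (t : ℕ) (cand : List (Fin n₁)) (s : Mem n₁ n₂)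
    (c : List (Fin n₁)) (ws : List (Fin n₂)) (s' : Mem n₁ n₂) : Prop where
  isMatch : IsMatch L s'
  nodup : c.Nodup
  mem_iff : ∀ v, v ∈ c ↔ v ∈ cand ∧ ∃ w ∈ L.out v, rt s w = none
  ptrOK : ∀ v ∈ c, PtrOK L s' v
  ws_nodup : ws.Nodup
  mem_ws : ∀ w, w ∈ ws ↔ ∃ v ∈ c, par s v = some w
  lab_eq : ∀ w, lab s' w = if w ∈ ws then (t, 1) else lab s w
  ptr_eq : ∀ v, v ∉ cand → ptrAt s' v = ptrAt s v
  par_eq : ∀ v, par s' v = par s v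
  rt_eq : ∀ w, rt s' w = rt s w
  vis₁_eq : ∀ v, vis₁ s' v = vis₁ s v
  vis₂_eq : ∀ w, vis₂ s' w = vis₂ s w

/-- Resuming at the pointer loses nothing, because all nodes before it are roots. The time bound
does not use the saving: every scan is charged a full `scanBound`. -/
theorem layerOne_spec (hL : L.Sizes m κ) {t : ℕ} {cand : List (Fin n₁)} {s : Mem n₁ n₂}
    (hs : IsMatch L s) (hc : cand.Nodup) (hptr : ∀ v ∈ cand, PtrOK L s v)
    (hpar : ∀ v ∈ cand, par s v ≠ none) :
    Ensures (layerOne t cand) s fun r s' n => LayerOneDone L t cand s r.1 r.2 s' ∧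
      n ≤ 7 * (cand.map (scanBound L κ)).sum + 1 := by
  induction cand generalizing s with
  | nil =>
    simp only [layerOne, ensures_bind, ensures_tick, ensures_ret]
    exact ⟨⟨hs, by simp, by simp, by simp, by simp, by simp, by simp, fun _ _ => rfl,
      fun _ => rfl, fun _ => rfl, fun _ => rfl, fun _ => rfl⟩, by simp⟩
  | cons v vs ih =>
    obtain ⟨hv, hvs⟩ := List.nodup_cons.1 hc
    obtain ⟨hpv, hpar⟩ := List.forall_mem_cons.1 hpar
    obtain ⟨hptv, hptr⟩ := List.forall_mem_cons.1 hptr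
    obtain ⟨l₀, h0, h0'⟩ := hptv
    simp only [layerOne, ensures_bind, ensures_tick]
    refine (ensures_readPtr _ _ _).2 ?_
    refine (seekWT₁_spec v _ s).mono fun r s₁ n => ?_
    rintro ⟨l₁, l₂, h1, h2, h3, h4, rfl, h5⟩
    have hlen := length_filter_roots_le hs hL (l := ptrAt s v) (v := v)
      (by rw [h0]; exact List.sublist_append_right _ _)
    have hptr' : ∀ v' ∈ vs, PtrOK L (Function.update s (.ptr v) l₂) v' := by
      intro v' hv'
      have hne : v' ≠ v := by rintro rfl; exact hv hv'
      simpa [PtrOK, hne] using hptr v' hv'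
    cases r with
    | none =>
      have hl₂ : l₂ = [] := by simpa using h3.symm
      subst hl₂
      refine (ih (hs.update_ptr v []) hvs hptr' (by simpa using hpar)).mono fun r s' n' => ?_
      rintro ⟨h, hn'⟩
      refine ⟨⟨h.isMatch, h.nodup, ?_, h.ptrOK, h.ws_nodup, by simpa using h.mem_ws,
        by simpa using h.lab_eq, ?_, by simpa using h.par_eq, by simpa using h.rt_eq,
        by simpa using h.vis₁_eq, by simpa using h.vis₂_eq⟩, ?_⟩
      · intro v'
        rw [h.mem_iff]
        rcases eq_or_ne v' v with rfl | hne
        · simp only [hv, false_and, List.mem_cons, true_or, true_and, false_iff, not_exists, not_and]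
          intro w hw
          rw [h0, h1] at hw
          simp at hw
          exact hw.elim (h0' w) (h2 w)
        · simp [hne]
      · intro v' hv'
        have := h.ptr_eq v' (fun hh => hv' (by simp [hh]))
        have hne : v' ≠ v := by rintro rfl; simp at hv'
        simpa [hne] using this
      · simp only [List.map_cons, List.sum_cons]
        omega
    | some w₀ =>
      obtain ⟨l₂', rfl⟩ : ∃ l₂', l₂ = w₀ :: l₂' := by
        cases l₂ with
        | nil => simp at h3
        | cons x l => simp at h3; exact ⟨l, by rw [h3]⟩
      have hw₀ := h4 w₀ rfl
      have hw₀v : w₀ ∈ L.out v := by rw [h0, h1]; simp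
      obtain ⟨w, hw⟩ := Option.ne_none_iff_exists'.1 hpv
      have hM := hs.update_ptr v (w₀ :: l₂')
      simp only [ensures_bind, ensures_getParent]
      have hw' : par (Function.update s (.ptr v) (w₀ :: l₂')) v = some w := by simpa using hw
      rw [hw']
      simp only [ensures_bind, ensures_write]
      refine (ih (hM.congr (by simp) (by simp) (by simp) (by simp) (by simp)) hvs
        (by simpa [PtrOK] using hptr') (by simpa using hpar)).mono fun r s' n' => ?_
      rintro ⟨h, hn'⟩
      simp only [ensures_ret]
      have hmw := h.mem_ws
      have hmc := h.mem_iff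
      simp at hmw hmc
      have hwr : w ∉ r.2 := by
        rw [hmw]
        rintro ⟨v', hv', hp⟩
        rw [hs.par_iff] at hp hw
        obtain rfl := Option.some.inj (hp.symm.trans hw)
        exact hv ((hmc _).1 hv').1
      have hptv := h.ptr_eq v hv
      simp at hptv
      refine ⟨⟨h.isMatch, List.nodup_cons.2 ⟨fun hh => hv ((hmc v).1 hh).1, h.nodup⟩, ?_,
        List.forall_mem_cons.2 ⟨⟨l₀ ++ l₁, ?_, ?_⟩, h.ptrOK⟩, List.nodup_cons.2 ⟨hwr, h.ws_nodup⟩,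
        ?_, ?_, ?_, by simpa using h.par_eq, by simpa using h.rt_eq, by simpa using h.vis₁_eq,
        by simpa using h.vis₂_eq⟩, ?_⟩
      · intro v'
        rw [List.mem_cons, hmc]
        rcases eq_or_ne v' v with rfl | hne
        · simp
          exact ⟨w₀, hw₀v, hw₀⟩
        · simp [hne]
      · rw [hptv, h0, h1, List.append_assoc]
      · intro w' hw'
        rw [h.rt_eq]
        simp at hw' ⊢
        exact hw'.elim (h0' w') (h2 w')
      · intro w'
        simp [hmw, hw, eq_comm]
      · intro w'
        rw [h.lab_eq]
        rcases eq_or_ne w' w with rfl | hne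
        · simp
        · simp [hne]
      · intro v' hv'
        have := h.ptr_eq v' (fun hh => hv' (by simp [hh]))
        have hne : v' ≠ v := by rintro rfl; simp at hv'
        simpa [hne] using this
      · simp only [List.map_cons, List.sum_cons]
        omega

end Initialization

end MatchingPseudoflow

namespace MatchingPseudoflow

/-! ### Breadth-first generation of the layers -/

section Layers

variable {n₁ n₂ : ℕ} {L : AdjLists n₁ n₂} {m κ : ℕ} {t : ℕ}

/-- The cells of the labels. -/
def LabelCell : Addr n₁ n₂ → Prop
  | .label _ => True
  | _ => False

/-- A breadth-first search has labelled the layers up to `p`, and the roots in `acc` in layer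
`p + 1`; the roots in the layers below `p` have been scanned. -/
structure Layered (L : AdjLists n₁ n₂) (t p : ℕ) (s : Mem n₁ n₂) (acc : List (Fin n₂)) :
    Prop where
  isMatch : IsMatch L s
  label : ∀ w, (lab s w).1 = t → rt s w ≠ none ∧ 1 ≤ (lab s w).2 ∧ (lab s w).2 ≤ p + 1
  nodup : acc.Nodup
  mem : ∀ w, w ∈ acc ↔ lab s w = (t, p + 1)
  closed : ∀ v w, w ∈ L.out v → (lab s w).1 = t → (lab s w).2 < p →
    ∃ x, par s v = some x ∧ (lab s x).1 = t ∧ (lab s x).2 ≤ (lab s w).2 + 1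
  first : ∀ v w, w ∈ L.out v → rt s w = none → ∃ x, par s v = some x ∧ lab s x = (t, 1)
  sharp : ∀ D k, LowerBound L s D k → ∀ w, (lab s w).1 = t → D w ≤ (lab s w).2

/-- Labels are only added in layer `q`. -/
structure Relabelled (t q : ℕ) (s s' : Mem n₁ n₂) : Prop where
  eqOff : EqOff LabelCell s s'
  keep : ∀ w, (lab s w).1 = t → lab s' w = lab s w
  new : ∀ w, lab s' w = (t, q) ∨ lab s' w = lab s w

theorem Relabelled.refl (t q : ℕ) (s : Mem n₁ n₂) : Relabelled t q s s :=
  ⟨EqOff.refl _ _, fun _ _ => rfl, fun _ => Or.inr rfl⟩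

theorem Relabelled.trans {q : ℕ} {s s' s'' : Mem n₁ n₂} (h : Relabelled t q s s')
    (h' : Relabelled t q s' s'') : Relabelled t q s s'' := by
  refine ⟨h.eqOff.trans h'.eqOff, fun w hw => ?_, fun w => (h'.new w).elim Or.inl fun hh => hh ▸ h.new w⟩
  rw [h'.keep w (by rwa [h.keep w hw]), h.keep w hw]

theorem Relabelled.par {q : ℕ} {s s' : Mem n₁ n₂} (h : Relabelled t q s s') (v : Fin n₁) :
    par s' v = par s v := h.eqOff (.parent v) id

theorem LowerBound.congr {s s' : Mem n₁ n₂} {D : Fin n₂ → ℕ} {k : ℕ} (h : LowerBound L s D k)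
    (hpar : ∀ v, par s' v = par s v) (hrt : ∀ w, rt s' w = rt s w) : LowerBound L s' D k :=
  ⟨fun w => by rw [hrt]; exact h.zero w, fun v x w => by rw [hpar]; exact h.step v x w,
    fun v w => by rw [hpar]; exact h.excess v w⟩

/-- Sharpness is inherited along the arc that discovers `x`: any lower bound satisfies `D x ≤ D w +
1 ≤ p + 1`. -/
theorem Layered.add {p : ℕ} {s : Mem n₁ n₂} {acc : List (Fin n₂)} (h : Layered L t p s acc)
    {v : Fin n₁} {w x : Fin n₂} (hw : w ∈ L.out v) (hlw : lab s w = (t, p))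
    (hx : par s v = some x) (hlx : (lab s x).1 ≠ t) :
    Layered L t p (Function.update s (.label x) (t, p + 1)) (x :: acc) := by
  constructor
  · exact h.isMatch.congr (by simp) (by simp) (by simp) (by simp) (by simp)
  · intro w'
    rcases eq_or_ne w' x with rfl | hne
    · simp [(h.isMatch.par_iff v w').1 hx]
    · simpa [hne] using h.label w'
  · exact List.nodup_cons.2 ⟨fun hh => hlx (by rw [(h.mem x).1 hh]), h.nodup⟩
  · intro w'
    rcases eq_or_ne w' x with rfl | hne
    · simp
    · simp [hne, h.mem]
  · intro v' w' hw' h1 h2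
    have hne : w' ≠ x := by rintro rfl; simp at h2
    simp [hne] at h1 h2 ⊢
    obtain ⟨y, hy, hy1, hy2⟩ := h.closed v' w' hw' h1 h2
    have hne' : y ≠ x := by rintro rfl; exact hlx hy1
    exact ⟨y, hy, by simp [hne', hy1, hy2]⟩
  · intro v' w' hw' h1
    simp at h1 ⊢
    obtain ⟨y, hy, hy1⟩ := h.first v' w' hw' h1
    have hne' : y ≠ x := by rintro rfl; exact hlx (by rw [hy1])
    exact ⟨y, hy, by simp [hne', hy1]⟩
  · intro D k hD w' h1
    have hD' : LowerBound L s D k := hD.congr (by simp) (by simp)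
    rcases eq_or_ne w' x with rfl | hne
    · have h2 := hD'.step v w' w hx hw
      have h3 := h.sharp D k hD' w (by rw [hlw])
      rw [hlw] at h3
      simp
      omega
    · simp [hne] at h1 ⊢
      exact h.sharp D k hD' w' h1

theorem scanIncoming_spec (hL : L.Sizes m κ) {p : ℕ} {w : Fin n₂} {l : List (Fin n₁)}
    {acc : List (Fin n₂)} {s : Mem n₁ n₂} (hl : l.Sublist (L.inn w)) (hs : Layered L t p s acc)
    (hw : lab s w = (t, p)) :
    Ensures (scanIncoming t p l acc) s fun r s' n => Layered L t p s' r.2 ∧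
      Relabelled t (p + 1) s s' ∧
      (r.1 = false → ∀ v ∈ l, ∃ x, par s' v = some x ∧ (lab s' x).1 = t) ∧
      (r.1 = true → ∃ v ∈ l, par s' v = none) ∧
      n ≤ 5 * (l.filter fun v => par s v ≠ none).length + 2 := by
  induction l generalizing s acc with
  | nil =>
    simp only [scanIncoming, ensures_bind, ensures_tick, ensures_ret]
    exact ⟨hs, Relabelled.refl _ _ _, by simp, by simp, by simp⟩
  | cons v l ih =>
    have hl' : l.Sublist (L.inn w) := (List.sublist_cons_self v l).trans hl
    have hwv : w ∈ L.out v := (hL.mem_inn v w).1 (hl.subset (by simp))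
    simp only [scanIncoming, ensures_bind, ensures_tick, ensures_getParent]
    cases hv : par s v with
    | none =>
      simp only [ensures_ret]
      exact ⟨hs, Relabelled.refl _ _ _, by simp, fun _ => ⟨v, by simp, hv⟩, by omega⟩
    | some x =>
      simp only [ensures_bind]
      refine ensures_getLabel fun k hk => ?_
      obtain ⟨u, hu⟩ : ∃ u, rt s x = some u := ⟨v, (hs.isMatch.par_iff v x).1 hv⟩
      simp only [labelAt, hu]
      rw [List.filter_cons_of_pos (by simp [hv])]
      by_cases hx : (lab s x).1 = t
      · rw [if_pos hx]
        refine (ih hl' hs hw).mono fun r s' n => ?_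
        rintro ⟨h1, h2, h3, h4, h5⟩
        refine ⟨h1, h2, fun hr => List.forall_mem_cons.2 ⟨⟨x, ?_, ?_⟩, h3 hr⟩, fun hr => ?_, ?_⟩
        · rw [h2.par, hv]
        · rw [h2.keep x hx, hx]
        · obtain ⟨v', hv', h6⟩ := h4 hr
          exact ⟨v', by simp [hv'], h6⟩
        · simp only [List.length_cons]
          omega
      · rw [if_neg hx]
        simp only [ensures_bind, ensures_write]
        have hne : w ≠ x := by rintro rfl; simp [hw] at hx
        refine (ih hl' (hs.add hwv hw hv hx) (by simpa [hne] using hw)).mono fun r s' n => ?_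
        rintro ⟨h1, h2, h3, h4, h5⟩
        have h0 : Relabelled t (p + 1) s (Function.update s (.label x) (t, p + 1)) := by
          refine ⟨(EqOff.refl _ _).update (.label x) _ trivial, fun w' hw' => ?_, fun w' => ?_⟩
          · have : w' ≠ x := by rintro rfl; exact hx hw'
            simp [this]
          · rcases eq_or_ne w' x with rfl | hne
            · simp
            · simp [hne]
        refine ⟨h1, h0.trans h2, fun hr => List.forall_mem_cons.2 ⟨⟨x, ?_, ?_⟩, h3 hr⟩,
          fun hr => ?_, ?_⟩
        · rw [h2.par]
          simpa using hv
        · rw [h2.keep x (by simp)]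
          simp
        · obtain ⟨v', hv', h6⟩ := h4 hr
          exact ⟨v', by simp [hv'], h6⟩
        · simp at h5 ⊢
          omega

/-- The number of incoming arcs of `w` scanned until an `ST₁` neighbour is found. -/
def inBound (L : AdjLists n₁ n₂) (κ : ℕ) (w : Fin n₂) : ℕ := min (L.inn w).length κ + 1

theorem scanLayer_spec (hL : L.Sizes m κ) {p : ℕ} {ws acc : List (Fin n₂)} {s : Mem n₁ n₂}
    (hs : Layered L t p s acc) (hw : ∀ w ∈ ws, lab s w = (t, p)) :
    Ensures (scanLayer t p ws acc) s fun r s' n => Layered L t p s' r.2 ∧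
      Relabelled t (p + 1) s s' ∧
      (r.1 = false → ∀ w ∈ ws, ∀ v, w ∈ L.out v → ∃ x, par s' v = some x ∧ (lab s' x).1 = t) ∧
      (r.1 = true → ∃ w ∈ ws, ∃ v, w ∈ L.out v ∧ par s' v = none) ∧
      n ≤ 5 * (ws.map (inBound L κ)).sum + 1 := by
  induction ws generalizing s acc with
  | nil =>
    simp only [scanLayer, ensures_bind, ensures_tick, ensures_ret]
    exact ⟨hs, Relabelled.refl _ _ _, by simp, by simp, by simp⟩
  | cons w ws ih =>
    simp only [scanLayer, ensures_bind, ensures_tick, ensures_getInn, hs.isMatch.inn]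
    obtain ⟨hw, hws⟩ := List.forall_mem_cons.1 hw
    refine (scanIncoming_spec hL (List.Sublist.refl _) hs hw).mono fun r s₁ n => ?_
    rintro ⟨h1, h2, h3, h4, h5⟩
    have h6 := length_filter_le hL (List.Sublist.refl (L.inn w))
      (Finset.univ.filter fun v => par s v ≠ none)
    have h7 : (Finset.univ.filter fun v => par s v ≠ none).card ≤ κ := hs.isMatch.msize_le hL
    simp only [Finset.mem_filter, Finset.mem_univ, true_and] at h6
    have h8 : inBound L κ w = min (L.inn w).length κ + 1 := rfl
    obtain ⟨b, acc'⟩ := r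
    cases b with
    | true =>
      simp only [if_true, ensures_ret]
      refine ⟨h1, h2, by simp, fun _ => ?_, ?_⟩
      · obtain ⟨v, hv, hn⟩ := h4 rfl
        exact ⟨w, by simp, v, (hL.mem_inn v w).1 hv, hn⟩
      · simp only [List.map_cons, List.sum_cons]
        omega
    | false =>
      simp only [Bool.false_eq_true, if_false]
      refine (ih h1 fun w' hw' => ?_).mono fun r s' n' => ?_
      · rw [h2.keep w' (by rw [hws w' hw']), hws w' hw']
      rintro ⟨g1, g2, g3, g4, g5⟩
      refine ⟨g1, h2.trans g2, fun hr => List.forall_mem_cons.2 ⟨fun v hv => ?_, g3 hr⟩,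
        fun hr => ?_, ?_⟩
      · obtain ⟨x, hx, hx'⟩ := h3 rfl v ((hL.mem_inn v w).2 hv)
        exact ⟨x, by rw [g2.par, hx], by rw [g2.keep x hx', hx']⟩
      · obtain ⟨w', hw', h⟩ := g4 hr
        exact ⟨w', by simp [hw'], h⟩
      · simp only [List.map_cons, List.sum_cons]
        omega

/-- The outcome of the generation of the layers: if an `ST₁` branch is reached from layer `p`, a
layered network, and otherwise the matching is maximum. -/
def LayersDone (L : AdjLists n₁ n₂) (κ t : ℕ) (s' : Mem n₁ n₂) :
    Option (ℕ × List (Fin n₂)) → Prop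
  | none => κ ≤ msize s'
  | some (p, ws) => 1 ≤ p ∧ (∃ acc, Layered L t p s' acc) ∧ ws.Nodup ∧
      (∀ w, w ∈ ws ↔ lab s' w = (t, p)) ∧ ∃ w ∈ ws, ∃ v, w ∈ L.out v ∧ par s' v = none

/-- The roots labelled in layer `q` or above. -/
def labelledFrom (t q : ℕ) (s : Mem n₁ n₂) : Finset (Fin n₂) :=
  Finset.univ.filter fun w => (lab s w).1 = t ∧ q ≤ (lab s w).2

/-- When all labelled roots have been scanned, the children of the labelled roots and the unlabelled
roots form a vertex cover with one node for each matching edge. -/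
theorem Layered.kappa_le (hL : L.Sizes m κ) {q : ℕ} {s : Mem n₁ n₂} {acc : List (Fin n₂)}
    (hs : Layered L t q s acc) (hq : ∀ w, (lab s w).1 = t → (lab s w).2 < q) :
    κ ≤ msize s := by
  have h1 := hs.isMatch.kappa_le hL (Finset.univ.filter fun w => (lab s w).1 = t)
    ((roots s).filter fun w => ¬ (lab s w).1 = t) (by
      intro v w hw hT
      simp only [Finset.mem_filter, mem_roots, not_and, not_not] at hT
      by_cases hr : rt s w = none
      · obtain ⟨x, hx, hx'⟩ := hs.first v w hw hr
        exact ⟨x, by simp [hx'], hx⟩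
      · obtain ⟨x, hx, hx', -⟩ := hs.closed v w hw (hT hr) (hq w (hT hr))
        exact ⟨x, by simp [hx'], hx⟩)
  simp only [Finset.mem_filter, Finset.mem_univ, true_and] at h1
  rwa [Finset.card_filter_add_card_filter_not, hs.isMatch.card_roots] at h1

/-- Each generated layer is nonempty, so the labelled roots below `q` increase in number with every
step. There are at most `n₁` roots, hence `hb` ensures that the iteration bound is never what ends
the search too early. -/
theorem layers_spec (hL : L.Sizes m κ) {b q : ℕ} {ws : List (Fin n₂)} {s : Mem n₁ n₂}
    (hs : Layered L t q s []) (hq : 1 ≤ q) (hnd : ws.Nodup) (hws : ∀ w, w ∈ ws ↔ lab s w = (t, q))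
    (hb : n₁ ≤ b + (Finset.univ.filter fun w => (lab s w).1 = t ∧ (lab s w).2 < q).card) :
    Ensures (layers t b q ws) s fun r s' n => LayersDone L κ t s' r ∧ EqOff LabelCell s s' ∧
      (∀ w, (lab s w).1 = t → lab s' w = lab s w) ∧
      (∀ w, (lab s' w).1 = t ∨ lab s' w = lab s w) ∧ (∀ w, (lab s' w).1 = t → rt s' w ≠ none) ∧
      n ≤ 7 * ∑ w ∈ labelledFrom t q s', inBound L κ w + 1 := by
  have hnone : ws = [] → LayersDone L κ t s none := by
    rintro rfl
    refine hs.kappa_le hL fun w hw => ?_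
    have h1 := (hs.label w hw).2.2
    have h2 : lab s w ≠ (t, q) := fun h => by simpa using (hws w).2 h
    have h3 : lab s w ≠ (t, q + 1) := fun h => by simpa using (hs.mem w).2 h
    have h4 : ∀ k, (lab s w).2 = k → lab s w = (t, k) := fun k hk => Prod.ext hw hk
    rcases Nat.lt_trichotomy (lab s w).2 q with h5 | h5 | h5
    · exact h5
    · exact absurd (h4 q h5) h2
    · exact absurd (h4 (q + 1) (by omega)) h3
  have hsub : ∀ w ∈ ws, w ∈ roots s := fun w hw =>
    mem_roots.2 (hs.label w (by rw [(hws w).1 hw])).1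
  induction b generalizing q ws s with
  | zero =>
    simp only [layers, ensures_bind, ensures_tick, ensures_ret]
    refine ⟨hnone ?_, EqOff.refl _ _, fun _ _ => trivial, fun _ => by simp,
      fun w hw => (hs.label w hw).1, by omega⟩
    by_contra hne
    obtain ⟨w, hw⟩ := List.exists_mem_of_ne_nil ws hne
    have h1 : (Finset.univ.filter fun w => (lab s w).1 = t ∧ (lab s w).2 < q).card <
        (roots s).card := by
      refine Finset.card_lt_card (Finset.ssubset_iff_subset_ne.2 ⟨fun w' hw' => ?_, fun he => ?_⟩)
      · simp only [Finset.mem_filter, Finset.mem_univ, true_and] at hw'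
        exact mem_roots.2 (hs.label w' hw'.1).1
      · have := hsub w hw
        rw [← he] at this
        simp [(hws w).1 hw] at this
    have h2 := msize_le_left s
    rw [hs.isMatch.card_roots] at h1
    omega
  | succ b ih =>
    cases ws with
    | nil =>
      simp only [layers, ensures_bind, ensures_tick, ensures_ret]
      exact ⟨hnone rfl, EqOff.refl _ _, fun _ _ => trivial, fun _ => by simp,
      fun w hw => (hs.label w hw).1, by omega⟩
    | cons w₀ ws =>
      simp only [layers, ensures_bind, ensures_tick]
      refine (scanLayer_spec hL hs fun w hw => (hws w).1 hw).mono fun r s₁ n => ?_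
      rintro ⟨h1, h2, h3, h4, h5⟩
      have hws₁ : ∀ w, w ∈ w₀ :: ws ↔ lab s₁ w = (t, q) := by
        intro w
        rw [hws]
        constructor
        · intro h
          rw [h2.keep w (by rw [h]), h]
        · intro h
          rcases h2.new w with h6 | h6
          · rw [h] at h6
            simp at h6
          · rwa [← h6]
      have hsum : ∀ w₀ ws, (w₀ :: ws).Nodup → ((w₀ :: ws).map (inBound L κ)).sum =
          ∑ w ∈ (w₀ :: ws).toFinset, inBound L κ w := fun w₀ ws h => (List.sum_toFinset _ h).symm
      -- Nonemptiness of the layer absorbs the constant overhead per layer, which is why the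
      -- coefficient grows from `5` to `7`.
      have hone : 1 ≤ ((w₀ :: ws).map (inBound L κ)).sum := by
        simp [inBound]
        omega
      rw [hsum w₀ ws hnd] at h5 hone
      obtain ⟨b', acc⟩ := r
      cases b' with
      | true =>
        simp only [if_true, ensures_ret]
        refine ⟨⟨hq, ⟨acc, h1⟩, hnd, hws₁, h4 rfl⟩, h2.eqOff, h2.keep,
          fun w => (h2.new w).imp_left fun hh => by rw [hh], fun w hw => (h1.label w hw).1, ?_⟩
        have h6 : ∑ w ∈ (w₀ :: ws).toFinset, inBound L κ w ≤
            ∑ w ∈ labelledFrom t q s₁, inBound L κ w := by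
          refine Finset.sum_le_sum_of_subset fun w hw => ?_
          rw [List.mem_toFinset, hws₁] at hw
          simp [labelledFrom, hw]
        omega
      | false =>
        simp only [Bool.false_eq_true, if_false]
        have h6 : Layered L t (q + 1) s₁ [] := by
          refine ⟨h1.isMatch, fun w hw => ?_, by simp, fun w => ?_, fun v w hw hl hlt => ?_,
            h1.first, h1.sharp⟩
          · have := h1.label w hw
            exact ⟨this.1, this.2.1, by omega⟩
          · simp only [List.not_mem_nil, false_iff]
            intro h
            have := h1.label w (by rw [h])
            rw [h] at this
            simp at this
          · rcases Nat.lt_succ_iff_lt_or_eq.1 hlt with h7 | h7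
            · exact h1.closed v w hw hl h7
            · obtain ⟨x, hx, hx'⟩ := h3 rfl w ((hws₁ w).2 (Prod.ext hl h7)) v hw
              exact ⟨x, hx, hx', by rw [h7]; exact (h1.label x hx').2.2⟩
        refine (ih h6 (by omega) h1.nodup h1.mem ?_ ?_ ?_).mono fun r s' n' => ?_
        · refine hb.trans ?_
          rw [Nat.add_right_comm, Nat.add_assoc]
          refine Nat.add_le_add_left (Nat.succ_le_of_lt (Finset.card_lt_card
            (Finset.ssubset_iff_subset_ne.2 ⟨fun w hw => ?_, fun he => ?_⟩))) b
          · simp only [Finset.mem_filter, Finset.mem_univ, true_and] at hw ⊢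
            rw [h2.keep w hw.1]
            omega
          · have h7 : w₀ ∈ Finset.univ.filter fun w => (lab s w).1 = t ∧ (lab s w).2 < q := by
              rw [he]
              simp [(hws₁ w₀).1 (by simp)]
            simp [(hws w₀).1 (by simp)] at h7
        · rintro he
          have he : acc = [] := he
          subst he
          refine h6.kappa_le hL fun w hw => ?_
          have h7 := h1.label w hw
          have h8 := (h1.mem w).2
          by_contra h9
          simpa using h8 (Prod.ext hw (by simp; omega))
        · intro w hw
          exact mem_roots.2 (h1.label w (by rw [(h1.mem w).1 hw])).1
        · rintro ⟨g1, g2, g3, g5, g6, g4⟩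
          refine ⟨g1, h2.eqOff.trans g2, fun w hw => ?_, fun w => ?_, g6, ?_⟩
          · rw [g3 w (by rwa [h2.keep w hw]), h2.keep w hw]
          · rcases g5 w with g7 | g7
            · exact Or.inl g7
            · rw [g7]
              exact (h2.new w).imp_left fun hh => by rw [hh]
          · have h7 : ∑ w ∈ (w₀ :: ws).toFinset, inBound L κ w +
                ∑ w ∈ labelledFrom t (q + 1) s', inBound L κ w ≤
                ∑ w ∈ labelledFrom t q s', inBound L κ w := by
              have hl : ∀ w ∈ (w₀ :: ws).toFinset, lab s' w = (t, q) := by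
                intro w hw
                rw [List.mem_toFinset, hws₁] at hw
                rw [g3 w (by rw [hw]), hw]
              rw [← Finset.sum_union]
              · refine Finset.sum_le_sum_of_subset fun w hw => ?_
                rcases Finset.mem_union.1 hw with hw | hw
                · simp [labelledFrom, hl w hw]
                · simp [labelledFrom] at hw ⊢
                  omega
              · refine Finset.disjoint_left.2 fun w hw hw' => ?_
                simp [labelledFrom, hl w hw] at hw'
            omega

end Layers

end MatchingPseudoflow

namespace MatchingPseudoflow

/-! ### Whole stages: from labels to a layered network, cost, and number of stages -/

section Stages

variable {n₁ n₂ : ℕ} {L : AdjLists n₁ n₂} {m κ : ℕ} {t : ℕ}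

/-- The label of a root, all layers above `p` being merged. -/
def cappedLabel (t p : ℕ) (s : Mem n₁ n₂) (w : Fin n₂) : ℕ :=
  if rt s w = none then 0 else if (lab s w).1 = t then (lab s w).2 else p + 1

/-- The label of a node of `V₁`. -/
def nodeLabel (t p : ℕ) (s : Mem n₁ n₂) (v : Fin n₁) : ℕ :=
  ((par s v).map (cappedLabel t p s)).getD (p + 1)

theorem Layered.cappedLabel_of_label {p : ℕ} {s : Mem n₁ n₂} {acc : List (Fin n₂)}
    (hs : Layered L t p s acc) {w : Fin n₂} (hw : (lab s w).1 = t) :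
    cappedLabel t p s w = (lab s w).2 := by
  simp [cappedLabel, hw, (hs.label w hw).1]

theorem Layered.cappedLabel_le {p : ℕ} {s : Mem n₁ n₂} {acc : List (Fin n₂)}
    (hs : Layered L t p s acc) (w : Fin n₂) : cappedLabel t p s w ≤ p + 1 := by
  have := hs.label w
  unfold cappedLabel
  split_ifs <;> grind

theorem Layered.cappedLabel_eq_zero {p : ℕ} {s : Mem n₁ n₂} {acc : List (Fin n₂)}
    (hs : Layered L t p s acc) (w : Fin n₂) : cappedLabel t p s w = 0 ↔ rt s w = none := by
  have := hs.label w
  unfold cappedLabel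
  split_ifs <;> grind

theorem Layered.nodeLabel_of_par {p : ℕ} {s : Mem n₁ n₂} {v : Fin n₁} {w : Fin n₂}
    (h : par s v = some w) : nodeLabel t p s v = cappedLabel t p s w := by
  simp [nodeLabel, h]

theorem Layered.nodeLabel_le {p : ℕ} {s : Mem n₁ n₂} {acc : List (Fin n₂)}
    (hs : Layered L t p s acc) (v : Fin n₁) : nodeLabel t p s v ≤ p + 1 := by
  cases hv : par s v with
  | none => simp [nodeLabel, hv]
  | some w => rw [nodeLabel_of_par hv]; exact hs.cappedLabel_le w

/-- The layered network generated by the breadth-first search. -/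
def Layered.layering {p : ℕ} {s : Mem n₁ n₂} {acc : List (Fin n₂)} (hs : Layered L t p s acc) :
    Layering L where
  t := t
  p := p
  d := cappedLabel t p s
  lam := nodeLabel t p s
  child := rt s
  cell := lab s
  lam_le v w hw := by
    by_cases hr : rt s w = none
    · obtain ⟨x, hx, hx'⟩ := hs.first v w hw hr
      rw [nodeLabel_of_par hx, hs.cappedLabel_of_label (by rw [hx']), hx']
      simp
    · rcases lt_or_ge (cappedLabel t p s w) p with h | h
      · have hl : (lab s w).1 = t := by
          by_contra hn
          simp [cappedLabel, hr, hn] at h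
        rw [hs.cappedLabel_of_label hl] at h ⊢
        obtain ⟨x, hx, hx', hx''⟩ := hs.closed v w hw hl h
        rwa [nodeLabel_of_par hx, hs.cappedLabel_of_label hx']
      -- From layer `p` on the inequality holds by the cap alone; this is needed because the scan of
      -- layer `p` stops at the first free tail.
      · exact (hs.nodeLabel_le v).trans (Nat.succ_le_succ h)
  one_le_lam v := by
    cases hv : par s v with
    | none => simp [nodeLabel, hv]
    | some w =>
      rw [nodeLabel_of_par hv, Nat.one_le_iff_ne_zero, Ne, hs.cappedLabel_eq_zero,
        (hs.isMatch.par_iff v w).1 hv]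
      simp
  lam_child w u hu := nodeLabel_of_par ((hs.isMatch.par_iff u w).2 hu)
  cell_iff w q hw hq := by
    rw [Ne, hs.cappedLabel_eq_zero] at hw
    simp only [cappedLabel, if_neg hw]
    split_ifs with h
    · simp [h]
    · simp only [h, false_and, false_iff]
      omega

/-- No flag carries the number `t` yet, so the conditions on visited nodes are vacuous and `count`
holds with equality. -/
theorem Layered.between {p : ℕ} {s : Mem n₁ n₂} {acc : List (Fin n₂)} (hs : Layered L t p s acc)
    (h₁ : ∀ v, vis₁ s v ≠ t) (h₂ : ∀ w, vis₂ s w ≠ t) : hs.layering.Between (msize s) s := by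
  have ht : hs.layering.t = t := rfl
  refine ⟨⟨hs.isMatch, fun _ => rfl, fun w hw => ?_, fun w hw => ?_, fun _ _ _ => rfl,
    fun w _ hw => absurd hw (h₂ w)⟩, fun v hv => ?_, fun v hv => absurd hv (h₁ v), ?_⟩
  · have := (hs.cappedLabel_eq_zero w).1 hw
    simp [ht, h₂, this]
  · exact fun hn => hw ((hs.cappedLabel_eq_zero w).2 hn)
  · change nodeLabel t p s v = p + 1
    simp [nodeLabel, hv]
  · simp [Layering.searched, ht, h₁]

theorem AdjLists.Sizes.kappa_le (hL : L.Sizes m κ) : κ ≤ m := by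
  refine (hL.le_cover (Finset.univ.filter fun v => L.out v ≠ []) ∅ fun v w hw => ?_).trans ?_
  · left
    simpa using List.ne_nil_of_mem hw
  · rw [Finset.card_empty, add_zero, Finset.card_eq_sum_ones]
    refine le_trans (Finset.sum_le_sum fun v hv => ?_)
      ((Finset.sum_le_sum_of_subset (Finset.subset_univ _)).trans hL.sum_out)
    exact List.length_pos_iff.2 (by simpa using hv)

theorem AdjLists.Sizes.kappa_le_left (hL : L.Sizes m κ) : κ ≤ n₁ := by
  simpa using hL.le_cover Finset.univ ∅ (by simp)

theorem kappa_le_min (hL : L.Sizes m κ) : κ ≤ min (κ ^ 2) m :=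
  le_min (Nat.le_self_pow two_ne_zero κ) hL.kappa_le

theorem min_mul_le (a k : ℕ) (hk : k ≤ (a + 1) * κ ^ 2) : min m k ≤ (a + 1) * min (κ ^ 2) m := by
  rcases le_total (κ ^ 2) m with h | h
  · rw [min_eq_left h]
    exact (min_le_right _ _).trans hk
  · rw [min_eq_right h]
    exact (min_le_left _ _).trans (Nat.le_mul_of_pos_left _ (by omega))

/-- One term `a + 1` comes from the arcs, and the other absorbs the additive ones, at most `(a + 1)
* κ`, through `κ ≤ min (κ ^ 2) m`. -/
theorem sum_scanBound_le_min (hL : L.Sizes m κ) (a : ℕ) (A : Finset (Fin n₁))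
    (hA : A.card ≤ (a + 1) * κ) :
    ∑ v ∈ A, scanBound L κ v ≤ 2 * ((a + 1) * min (κ ^ 2) m) := by
  have h1 := sum_scanBound_le hL A
  have h2 := min_mul_le (m := m) a (A.card * κ)
    (by rw [pow_two, ← mul_assoc]; exact Nat.mul_le_mul_right _ hA)
  have h3 := Nat.mul_le_mul_left (a + 1) (kappa_le_min hL)
  omega

theorem sum_inn_le_min (hL : L.Sizes m κ) (a : ℕ) (A : Finset (Fin n₂)) (hA : A.card ≤ κ) :
    ∑ w ∈ A, (min (L.inn w).length ((a + 1) * κ) + 1) ≤ (a + 2) * min (κ ^ 2) m := by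
  rw [Finset.sum_add_distrib, ← Finset.card_eq_sum_ones]
  have h1 := sum_min_le A (fun w => (L.inn w).length) ((a + 1) * κ) hL.sum_inn
  have h2 := min_mul_le (m := m) (κ := κ) a (A.card * ((a + 1) * κ)) (by
    rw [mul_left_comm, pow_two]
    exact Nat.mul_le_mul_left _ (Nat.mul_le_mul_right _ hA))
  have h3 := kappa_le_min hL
  rw [show a + 2 = a + 1 + 1 from rfl, Nat.succ_mul (a + 1)]
  omega

/-- The initial debt is a sum over roots. Reindexed by their children, it becomes a sum of scan
bounds over at most `κ` matched nodes. -/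
theorem Layered.debt_le {p : ℕ} {s : Mem n₁ n₂} {acc : List (Fin n₂)} (hL : L.Sizes m κ)
    (hs : Layered L t p s acc) : hs.layering.debt κ s ≤ 2 * min (κ ^ 2) m := by
  have h1 := sum_scanBound_le_min hL 0 (Finset.univ.filter fun v => par s v ≠ none)
    (by simpa [msize] using hs.isMatch.msize_le hL)
  rw [Nat.zero_add, Nat.one_mul] at h1
  refine le_trans ?_ h1
  calc hs.layering.debt κ s
      ≤ ∑ w, ((rt s w).map (scanBound L κ)).getD 0 := by
        refine Finset.sum_le_sum fun w _ => ?_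
        split_ifs
        · exact Nat.zero_le _
        · exact le_rfl
    _ = ∑ w, ∑ v, if rt s w = some v then scanBound L κ v else 0 := by
        refine Finset.sum_congr rfl fun w _ => ?_
        cases h : rt s w <;> simp
    _ = ∑ v, ∑ w, if par s v = some w then scanBound L κ v else 0 := by
        rw [Finset.sum_comm]
        simp only [hs.isMatch.par_iff]
    _ ≤ ∑ v ∈ Finset.univ.filter fun v => par s v ≠ none, scanBound L κ v := by
        rw [Finset.sum_filter]
        refine Finset.sum_le_sum fun v _ => ?_
        cases h : par s v <;> simp

/-- The invariant at the beginning of stage `t`, with candidates `cand` for the `1`-layer. -/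
structure StageStart (L : AdjLists n₁ n₂) (t : ℕ) (cand : List (Fin n₁)) (s : Mem n₁ n₂) :
    Prop where
  isMatch : IsMatch L s
  nodup : cand.Nodup
  par_ne : ∀ v ∈ cand, par s v ≠ none
  ptrOK : ∀ v ∈ cand, PtrOK L s v
  mem : ∀ v w, w ∈ L.out v → rt s w = none → v ∈ cand
  lab_lt : ∀ w, (lab s w).1 < t
  vis₁_lt : ∀ v, vis₁ s v < t
  vis₂_lt : ∀ w, vis₂ s w < t
  lower : ∃ D, LowerBound L s D t

/-- Every node with a free neighbour is a candidate, so layer `1` is complete; labels from earlier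
stages carry a number below `t` and are invisible. -/
theorem StageStart.layered {cand c : List (Fin n₁)} {ws : List (Fin n₂)} {s s' : Mem n₁ n₂}
    (hs : StageStart L t cand s) (h : LayerOneDone L t cand s c ws s') : Layered L t 1 s' [] := by
  have hlab : ∀ w, (lab s' w).1 = t → w ∈ ws ∧ lab s' w = (t, 1) := by
    intro w hw
    rw [h.lab_eq] at hw ⊢
    split_ifs at hw ⊢ with h1
    · exact ⟨h1, rfl⟩
    · exact absurd hw (hs.lab_lt w).ne
  refine ⟨h.isMatch, fun w hw => ?_, by simp, fun w => ?_, fun v w _ hw hlt => ?_,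
    fun v w hw hr => ?_, fun D k hD w hw => ?_⟩
  · obtain ⟨h1, h2⟩ := hlab w hw
    obtain ⟨v, -, hv⟩ := (h.mem_ws w).1 h1
    rw [h.rt_eq, (hs.isMatch.par_iff v w).1 hv, h2]
    simp
  · simp only [List.not_mem_nil, false_iff]
    intro hw
    rw [(hlab w (by rw [hw])).2] at hw
    simp at hw
  · rw [(hlab w hw).2] at hlt
    simp at hlt
  · rw [h.rt_eq] at hr
    have hv := hs.mem v w hw hr
    obtain ⟨x, hx⟩ := Option.ne_none_iff_exists'.1 (hs.par_ne v hv)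
    refine ⟨x, by rw [h.par_eq, hx], ?_⟩
    rw [h.lab_eq, if_pos ((h.mem_ws x).2 ⟨v, (h.mem_iff v).2 ⟨hv, w, hw, hr⟩, hx⟩)]
  · obtain ⟨h1, h2⟩ := hlab w hw
    obtain ⟨v, hv, hvw⟩ := (h.mem_ws w).1 h1
    obtain ⟨-, x, hx, hrx⟩ := (h.mem_iff v).1 hv
    have h3 := hD.step v w x (by rw [h.par_eq, hvw]) hx
    have h4 := hD.zero x (by rw [h.rt_eq, hrx])
    rw [h2]
    simp
    omega

theorem EqOff.layered_isMatch {s s' : Mem n₁ n₂} (h : EqOff LabelCell s s') (hs : IsMatch L s) :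
    IsMatch L s' :=
  hs.congr (fun v => h (.out v) id) (fun w => h (.inn w) id) (fun v => h (.parent v) id)
    (fun w => h (.right w) id) fun w => h (.left w) id

theorem Layered.lower_le {p k : ℕ} {s : Mem n₁ n₂} {acc : List (Fin n₂)} {D : Fin n₂ → ℕ}
    (hs : Layered L t p s acc) (hD : LowerBound L s D k) {v : Fin n₁} {w : Fin n₂}
    (hw : lab s w = (t, p)) (hwv : w ∈ L.out v) (hv : par s v = none) : k ≤ p := by
  have h1 := hD.excess v w hv hwv
  have h2 := hs.sharp D k hD w (by rw [hw])
  rw [hw] at h2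
  exact h1.trans h2

/-- The mergers of a stage increase the matching and the lower bound of the labels. -/
theorem Layered.mergers_spec (hL : L.Sizes m κ) {p : ℕ} {s : Mem n₁ n₂} {acc ws : List (Fin n₂)}
    (hs : Layered L t p s acc) (hp : 1 ≤ p) (h₁ : ∀ v, vis₁ s v < t) (h₂ : ∀ w, vis₂ s w < t)
    (hnd : ws.Nodup) (hws : ∀ w, w ∈ ws ↔ lab s w = (t, p))
    (hex : ∃ w ∈ ws, ∃ v, w ∈ L.out v ∧ par s v = none) :
    Ensures (stageMergers t p ws) s fun _ s' n => IsMatch L s' ∧ msize s < msize s' ∧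
      (∃ D, LowerBound L s' D (p + 1)) ∧ EqOff StageCell s s' ∧
      (∀ v, par s v ≠ none → par s' v ≠ none) ∧ (∀ w, rt s w ≠ none → rt s' w ≠ none) ∧
      (∀ v, vis₁ s' v ≤ t) ∧ (∀ w, vis₂ s' w ≤ t) ∧ n ≤ 168 * min (κ ^ 2) m + 1 := by
  have hc : ∀ w, hs.layering.child w ≠ none → hs.layering.d w ≠ 0 := fun w hw hd =>
    hw ((hs.cappedLabel_eq_zero w).1 hd)
  have hd : ∀ w, hs.layering.d w = hs.layering.p ↔ w ∈ ws := by
    intro w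
    change cappedLabel t p s w = p ↔ _
    rw [hws]
    constructor
    · intro h
      have hr : rt s w ≠ none := by
        rw [Ne, ← hs.cappedLabel_eq_zero]
        omega
      by_cases hl : (lab s w).1 = t
      · rw [hs.cappedLabel_of_label hl] at h
        exact Prod.ext hl h
      · simp [cappedLabel, hr, hl] at h
    · intro h
      rw [hs.cappedLabel_of_label (by rw [h]), h]
  have hB := hs.between (fun v => (h₁ v).ne) fun w => (h₂ w).ne
  refine (stageMergers_spec (Λ := hs.layering) hL hc hp (fun w hw => (hd w).2 hw) hB).mono
    fun _ s' n => ?_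
  rintro ⟨h3, h4, h5, h6⟩
  have hlow := h3.lowerBound hs.cappedLabel_le fun w v hw => h5 w ((hd w).1 hw) v
  have hrt : ∀ w, rt s w ≠ none → rt s' w ≠ none := fun w hw => h3.inv.pos w (hc w hw)
  refine ⟨h3.inv.isMatch, ?_, ⟨_, hlow⟩, h4.eqOff, h4.par, hrt, fun v => ?_, fun w => ?_, ?_⟩
  -- If the matching had not changed, the lower bound `p + 1` reached after the mergers would hold
  -- before them, although a free node is adjacent to a root labelled `p`.
  · refine h4.progress.resolve_left fun hpar => ?_
    obtain ⟨w, hw, v, hv, hn⟩ := hex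
    have hlow' := hlow.congr (s' := s) (fun v => (hpar v).symm) fun w => by
      have h7 : ∀ u, rt s w = some u ↔ rt s' w = some u := fun u => by
        rw [← hs.isMatch.par_iff, ← h3.inv.isMatch.par_iff, hpar]
      exact Option.ext h7
    have := hs.lower_le hlow' ((hws w).1 hw) hv hn
    change p + 1 ≤ p at this
    omega
  · rcases h4.flags₁ v with h | h
    · exact h.le
    · exact h.trans_le (h₁ v).le
  · rcases h4.flags₂ w with h | h
    · exact h.le
    · exact h.trans_le (h₂ w).le
  -- With `N = min (κ ^ 2) m`, the coefficient is `168 = 20 * 2 + 20 * 4 + 12 * 4`: debt, at most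
  -- `2κ` searches, and incoming arcs from at most `3κ` tails.
  · have g1 := hs.debt_le hL
    have g2 := sum_scanBound_le_min hL 1 _ (h3.card_searched_le hL hc)
    have g3 := sum_inn_le_min hL 2 ws.toFinset (by
      refine (Finset.card_le_card fun w hw => ?_).trans
        (hs.isMatch.card_roots.trans_le (hs.isMatch.msize_le hL))
      rw [List.mem_toFinset, hws] at hw
      exact mem_roots.2 (hs.label w (by rw [hw])).1)
    rw [List.sum_toFinset _ hnd] at g3
    change (ws.map fun w => min (L.inn w).length (3 * κ) + 1).sum ≤ 4 * min (κ ^ 2) m at g3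
    omega

/-- The potential that bounds the number of the remaining stages. -/
def stagePotential (κ r t k : ℕ) : ℕ := (r - t) + min (κ - k) r

/-- Before stage `r` the first summand drops. From then on `t * (κ - k) ≤ κ < r * r` forces the
deficit below `r`, so the minimum is the deficit, which drops. -/
theorem stagePotential_lt {r k k' : ℕ} (hr : κ < r * r) (hk : k < k') (hk' : k' ≤ κ)
    (ht : t * (κ - k) ≤ κ) : stagePotential κ r (t + 1) k' < stagePotential κ r t k := by
  unfold stagePotential
  rcases lt_or_ge t r with h | h
  · omega
  · have : κ - k < r := by
      by_contra hn
      have := Nat.mul_le_mul h (not_lt.1 hn)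
      omega
    omega

/-- Each stage costs at most `200 * (min (κ ^ 2) m + 1)` and decreases the potential. The iteration
bound `b` suffices because the matching grows in each stage that does not stop. -/
theorem stages_spec (hL : L.Sizes m κ) {r b : ℕ} (hr : κ < r * r) {cand : List (Fin n₁)}
    {s : Mem n₁ n₂} (hs : StageStart L t cand s) (hb : n₁ ≤ b + msize s) :
    Ensures (stages b t cand) s fun _ s' n => IsMatch L s' ∧ κ ≤ msize s' ∧
      n ≤ 200 * (min (κ ^ 2) m + 1) * (stagePotential κ r t (msize s) + 1) := by
  induction b generalizing t cand s with
  | zero =>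
    simp only [stages, ensures_tick]
    refine ⟨hs.isMatch, hL.kappa_le_left.trans (by omega), ?_⟩
    exact Nat.mul_pos (by omega) (by omega)
  | succ b ih =>
    simp only [stages, ensures_bind, ensures_tick]
    refine (layerOne_spec hL hs.isMatch hs.nodup hs.ptrOK hs.par_ne).mono fun c s₁ n₀ => ?_
    obtain ⟨c, ws⟩ := c
    rintro ⟨h1, hn₀⟩
    have hl₁ := hs.layered h1
    have hws₁ : ∀ w, w ∈ ws ↔ lab s₁ w = (t, 1) := by
      intro w
      rw [h1.lab_eq]
      split_ifs with h
      · simp [h]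
      · simp only [h, false_iff]
        intro h2
        have := hs.lab_lt w
        rw [h2] at this
        simp at this
    refine (layers_spec hL hl₁ le_rfl h1.ws_nodup hws₁ (Nat.le_add_right _ _)).mono
      fun o s₂ n₃ => ?_
    rintro ⟨h2, h3, -, h4, h6, h5⟩
    have hM₂ := h3.layered_isMatch h1.isMatch
    have hrt₂ : ∀ w, rt s₂ w = rt s w := fun w => (h3 (.right w) id).trans (h1.rt_eq w)
    have hpar₂ : ∀ v, par s₂ v = par s v := fun v => (h3 (.parent v) id).trans (h1.par_eq v)
    have hms : msize s₂ = msize s := by simp [msize, hpar₂]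
    have hlab₂ : ∀ w, (lab s₂ w).1 ≤ t := by
      intro w
      rcases h4 w with h | h
      · exact h.le
      · rw [h, h1.lab_eq]
        split_ifs
        · exact le_rfl
        · exact (hs.lab_lt w).le
    have g1 : (cand.map (scanBound L κ)).sum ≤ 2 * min (κ ^ 2) m := by
      rw [← List.sum_toFinset _ hs.nodup]
      have := sum_scanBound_le_min hL 0 cand.toFinset ((Finset.card_le_card
        (t := Finset.univ.filter fun v => par s v ≠ none) fun v hv => by
          simpa using hs.par_ne v (List.mem_toFinset.1 hv)).trans (by
            rw [Nat.zero_add, Nat.one_mul]; exact hs.isMatch.msize_le hL))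
      simpa using this
    have g2 : ∑ w ∈ labelledFrom t 1 s₂, inBound L κ w ≤ 2 * min (κ ^ 2) m := by
      have := sum_inn_le_min hL 0 (labelledFrom t 1 s₂) ((Finset.card_le_card
        (t := roots s₂) fun w hw => ?_).trans (hM₂.card_roots.trans_le (hM₂.msize_le hL)))
      · simpa [inBound] using this
      · simp only [labelledFrom, Finset.mem_filter, Finset.mem_univ, true_and] at hw
        exact mem_roots.2 (h6 w hw.1)
    cases o with
    | none =>
      simp only [ensures_ret]
      refine ⟨hM₂, h2, le_trans ?_ (Nat.le_mul_of_pos_right _ (Nat.succ_pos _))⟩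
      omega
    | some o =>
      obtain ⟨p, layer⟩ := o
      obtain ⟨hp, ⟨acc, hl₂⟩, hnd, hmem, hex⟩ := h2
      simp only [ensures_bind]
      have hv₁ : ∀ v, vis₁ s₂ v = vis₁ s v := fun v => (h3 (.visited₁ v) id).trans (h1.vis₁_eq v)
      have hv₂ : ∀ w, vis₂ s₂ w = vis₂ s w := fun w => (h3 (.visited₂ w) id).trans (h1.vis₂_eq w)
      refine (hl₂.mergers_spec hL hp (fun v => by rw [hv₁]; exact hs.vis₁_lt v)
        (fun w => by rw [hv₂]; exact hs.vis₂_lt w) hnd hmem hex).mono fun _ s₃ n₄ => ?_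
      rintro ⟨k1, k2, ⟨D', k3⟩, k4, k5, k6, k7, k8, k9⟩
      obtain ⟨D, hD⟩ := hs.lower
      -- The lower bound `t` carried over from the preceding stages cannot exceed the layer where a
      -- free node is met, so the new bound `p + 1` is at least `t + 1`.
      have htp : t ≤ p := by
        obtain ⟨w, hw, v, hv, hn⟩ := hex
        exact hl₂.lower_le (hD.congr hpar₂ hrt₂) ((hmem w).1 hw) hv hn
      have hnext : StageStart L (t + 1) c s₃ := by
        refine ⟨k1, h1.nodup, fun v hv => k5 v ?_, fun v hv => ?_, fun v w hw hr => ?_, fun w => ?_,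
          fun v => Nat.lt_succ_of_le (k7 v), fun w => Nat.lt_succ_of_le (k8 w),
          ⟨D', k3.zero, k3.step, fun v w hv hw => (Nat.succ_le_succ htp).trans (k3.excess v w hv hw)⟩⟩
        · rw [hpar₂]
          exact hs.par_ne v ((h1.mem_iff v).1 hv).1
        · obtain ⟨l, hl, hl'⟩ := h1.ptrOK v hv
          have e1 : ptrAt s₃ v = ptrAt s₁ v := (k4 (.ptr v) id).trans (h3 (.ptr v) id)
          refine ⟨l, by rw [e1, hl], fun w hw => k6 w ?_⟩
          rw [hrt₂, ← h1.rt_eq]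
          exact hl' w hw
        · have hr' : rt s w = none := by
            by_contra hn
            exact k6 w (by rwa [hrt₂]) hr
          exact (h1.mem_iff v).2 ⟨hs.mem v w hw hr', w, hw, hr'⟩
        · have e1 : lab s₃ w = lab s₂ w := k4 (.label w) id
          rw [e1]
          exact Nat.lt_succ_of_le (hlab₂ w)
      refine (ih hnext (by omega)).mono fun _ s' n₅ => ?_
      rintro ⟨j1, j2, j3⟩
      refine ⟨j1, j2, ?_⟩
      have hpot := stagePotential_lt hr (by rwa [hms] at k2) (k1.msize_le hL)
        (hD.mul_deficit_le hs.isMatch hL)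
      have h6 := Nat.mul_le_mul_left (200 * (min (κ ^ 2) m + 1)) (Nat.succ_le_of_lt hpot)
      rw [Nat.mul_succ] at j3 ⊢
      rw [Nat.mul_succ] at h6
      omega

end Stages

end MatchingPseudoflow

namespace MatchingPseudoflow

/-! ## From graphs to adjacency lists -/

section Graphs

variable {n₁ n₂ : ℕ} {G : SimpleGraph (Fin n₁ ⊕ Fin n₂)} {L : AdjLists n₁ n₂} {m κ : ℕ}

/-- The subgraph whose edges join `v` to `f v`. -/
def partnerSubgraph (G : SimpleGraph (Fin n₁ ⊕ Fin n₂)) (f : Fin n₁ → Option (Fin n₂))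
    (hf : ∀ v w, f v = some w → G.Adj (Sum.inl v) (Sum.inr w)) : G.Subgraph where
  verts := {a | ∃ v w, f v = some w ∧ (a = Sum.inl v ∨ a = Sum.inr w)}
  Adj a b := ∃ v w, f v = some w ∧ (a = Sum.inl v ∧ b = Sum.inr w ∨ a = Sum.inr w ∧ b = Sum.inl v)
  adj_sub := by
    rintro a b ⟨v, w, h, ⟨rfl, rfl⟩ | ⟨rfl, rfl⟩⟩
    · exact hf v w h
    · exact (hf v w h).symm
  edge_vert := by
    rintro a b ⟨v, w, h, ⟨rfl, rfl⟩ | ⟨rfl, rfl⟩⟩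
    · exact ⟨v, w, h, Or.inl rfl⟩
    · exact ⟨v, w, h, Or.inr rfl⟩
  symm := by
    constructor
    rintro a b ⟨v, w, h, ⟨rfl, rfl⟩ | ⟨rfl, rfl⟩⟩
    · exact ⟨v, w, h, Or.inr ⟨rfl, rfl⟩⟩
    · exact ⟨v, w, h, Or.inl ⟨rfl, rfl⟩⟩

theorem partnerSubgraph_adj {f : Fin n₁ → Option (Fin n₂)}
    {hf : ∀ v w, f v = some w → G.Adj (Sum.inl v) (Sum.inr w)} {v : Fin n₁} {w : Fin n₂} :
    (partnerSubgraph G f hf).Adj (Sum.inl v) (Sum.inr w) ↔ f v = some w := by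
  constructor
  · rintro ⟨v', w', h, ⟨h1, h2⟩ | ⟨h1, -⟩⟩
    · rw [Sum.inl.inj h1, Sum.inr.inj h2, h]
    · cases h1
  · exact fun h => ⟨v, w, h, Or.inl ⟨rfl, rfl⟩⟩

theorem partnerSubgraph_isMatching {f : Fin n₁ → Option (Fin n₂)}
    {hf : ∀ v w, f v = some w → G.Adj (Sum.inl v) (Sum.inr w)}
    (hinj : ∀ v v' w, f v = some w → f v' = some w → v = v') :
    (partnerSubgraph G f hf).IsMatching := by
  rintro a ⟨v, w, h, rfl | rfl⟩
  · refine ⟨Sum.inr w, ⟨v, w, h, Or.inl ⟨rfl, rfl⟩⟩, ?_⟩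
    rintro b ⟨v', w', h', ⟨h1, rfl⟩ | ⟨h1, -⟩⟩
    · rw [← Sum.inl.inj h1, h] at h'
      rw [Option.some.inj h']
    · cases h1
  · refine ⟨Sum.inl v, ⟨v, w, h, Or.inr ⟨rfl, rfl⟩⟩, ?_⟩
    rintro b ⟨v', w', h', ⟨h1, -⟩ | ⟨h1, rfl⟩⟩
    · cases h1
    · rw [← Sum.inr.inj h1] at h'
      rw [hinj v v' w h h']

theorem card_pairs_le_ncard (P : Finset (Fin n₁ × Fin n₂)) (E : Set (Sym2 (Fin n₁ ⊕ Fin n₂)))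
    (hP : ∀ x ∈ P, s(Sum.inl x.1, Sum.inr x.2) ∈ E) : P.card ≤ E.ncard := by
  classical
  have hinj : Set.InjOn (fun x : Fin n₁ × Fin n₂ =>
      s((Sum.inl x.1 : Fin n₁ ⊕ Fin n₂), Sum.inr x.2)) P := by
    rintro ⟨v, w⟩ - ⟨v', w'⟩ - h
    simpa using h
  rw [← Finset.card_image_of_injOn hinj, ← Set.ncard_coe_finset]
  refine Set.ncard_le_ncard (fun e he => ?_) (Set.toFinite _)
  simp only [Finset.coe_image, Set.mem_image] at he
  obtain ⟨x, hx, rfl⟩ := he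
  exact hP x hx

theorem card_le_ncard_partnerSubgraph {f : Fin n₁ → Option (Fin n₂)}
    {hf : ∀ v w, f v = some w → G.Adj (Sum.inl v) (Sum.inr w)} :
    (Finset.univ.filter fun v => f v ≠ none).card ≤ (partnerSubgraph G f hf).edgeSet.ncard := by
  refine le_trans ?_ (card_pairs_le_ncard (Finset.univ.filter fun x => f x.1 = some x.2) _
    fun x hx => ?_)
  · refine (Finset.card_le_card fun v hv => ?_).trans (Finset.card_image_le (f := Prod.fst))
    simp only [Finset.mem_filter, Finset.mem_univ, true_and] at hv
    obtain ⟨w, hw⟩ := Option.ne_none_iff_exists'.1 hv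
    exact Finset.mem_image.2 ⟨(v, w), by simpa using hw, rfl⟩
  · exact (partnerSubgraph_adj (hf := hf)).2 (by simpa using hx)

/-- Weak duality: choose a covering node on every matching edge; the choice is injective because
matching edges are disjoint. -/
theorem ncard_le_cover (hG : G.IsBipartiteWith (Set.range Sum.inl) (Set.range Sum.inr))
    {M : G.Subgraph} (hM : M.IsMatching) (A : Finset (Fin n₁)) (B : Finset (Fin n₂))
    (hc : ∀ v w, G.Adj (Sum.inl v) (Sum.inr w) → v ∈ A ∨ w ∈ B) :
    M.edgeSet.ncard ≤ A.card + B.card := by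
  have hex : ∀ e ∈ M.edgeSet, ∃ x ∈ A.disjSum B, x ∈ e := by
    intro e
    induction e using Sym2.ind with
    | _ a b =>
      intro hab
      have hadj : M.Adj a b := hab
      rcases hG.mem_of_adj hadj.adj_sub with ⟨⟨v, rfl⟩, w, rfl⟩ | ⟨⟨w, rfl⟩, v, rfl⟩
      · rcases hc v w hadj.adj_sub with h | h
        · exact ⟨Sum.inl v, by simpa using h, by simp⟩
        · exact ⟨Sum.inr w, by simpa using h, by simp⟩
      · rcases hc v w hadj.adj_sub.symm with h | h
        · exact ⟨Sum.inl v, by simpa using h, by simp⟩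
        · exact ⟨Sum.inr w, by simpa using h, by simp⟩
  rcases M.edgeSet.eq_empty_or_nonempty with h0 | ⟨e₀, -⟩
  · simp [h0]
  have : Nonempty (Fin n₁ ⊕ Fin n₂) := ⟨e₀.out.1⟩
  choose! g hg hg' using hex
  rw [← Finset.card_disjSum, ← Set.ncard_coe_finset]
  refine Set.ncard_le_ncard_of_injOn g hg (fun e he e' he' h => ?_) (Set.toFinite _)
  obtain ⟨y, hy⟩ := hg' e he
  obtain ⟨y', hy'⟩ := hg' e' he'
  rw [hy] at he
  rw [hy', ← h] at he'
  have h1 : M.Adj (g e) y := he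
  have h2 : M.Adj (g e) y' := he'
  rw [hy, hy', ← h, (hM (M.edge_vert h1)).unique h1 h2]

theorem AdjLists.Represents.sizes (hL : L.Represents G)
    (hG : G.IsBipartiteWith (Set.range Sum.inl) (Set.range Sum.inr)) :
    L.Sizes G.edgeSet.ncard (matchingNumber G) := by
  classical
  refine ⟨hL.out_nodup, hL.inn_nodup, fun v w => by rw [hL.mem_inn, hL.mem_out], ?_, ?_, ?_, ?_⟩
  · refine le_trans ?_ (card_pairs_le_ncard
      (Finset.univ.filter fun x : Fin n₁ × Fin n₂ => x.2 ∈ L.out x.1) _ fun x hx => ?_)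
    · rw [Finset.card_eq_sum_ones, Finset.sum_filter, Fintype.sum_prod_type]
      refine Finset.sum_le_sum fun v _ => ?_
      rw [← Finset.sum_filter, ← Finset.card_eq_sum_ones,
        ← List.toFinset_card_of_nodup (hL.out_nodup v)]
      exact Finset.card_le_card fun w hw => by simpa using hw
    · exact (hL.mem_out _ _).1 (by simpa using hx)
  · refine le_trans ?_ (card_pairs_le_ncard
      (Finset.univ.filter fun x : Fin n₁ × Fin n₂ => x.1 ∈ L.inn x.2) _ fun x hx => ?_)
    · rw [Finset.card_eq_sum_ones, Finset.sum_filter, Fintype.sum_prod_type_right]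
      refine Finset.sum_le_sum fun w _ => ?_
      rw [← Finset.sum_filter, ← Finset.card_eq_sum_ones,
        ← List.toFinset_card_of_nodup (hL.inn_nodup w)]
      exact Finset.card_le_card fun v hv => by simpa using hv
    · exact (hL.mem_inn _ _).1 (by simpa using hx)
  · intro f hf hinj
    exact (card_le_ncard_partnerSubgraph (hf := fun v w h => (hL.mem_out v w).1 (hf v w h))).trans
      (ncard_le_matchingNumber G _ (partnerSubgraph_isMatching hinj))
  · intro A B hc
    refine csSup_le ⟨0, ⊥, ?_, by simp⟩ ?_
    · intro v hv
      simp at hv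
    · rintro k ⟨M, hM, rfl⟩
      exact ncard_le_cover hG hM A B fun v w h => hc v w ((hL.mem_out v w).2 h)

theorem AdjLists.Represents.exists_mem_out (hL : L.Represents G)
    (hG : G.IsBipartiteWith (Set.range Sum.inl) (Set.range Sum.inr)) {e : Sym2 (Fin n₁ ⊕ Fin n₂)}
    (he : e ∈ G.edgeSet) : ∃ v w, w ∈ L.out v := by
  induction e using Sym2.ind with
  | _ a b =>
    have hadj : G.Adj a b := he
    rcases hG.mem_of_adj hadj with ⟨⟨v, rfl⟩, w, rfl⟩ | ⟨⟨w, rfl⟩, v, rfl⟩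
    · exact ⟨v, w, (hL.mem_out v w).2 hadj⟩
    · exact ⟨v, w, (hL.mem_out v w).2 hadj.symm⟩

end Graphs

/-! ### The complete algorithm and real-valued bounds -/

section Main

variable {n₁ n₂ : ℕ} {L : AdjLists n₁ n₂} {m κ : ℕ}

theorem AdjLists.Sizes.one_le_kappa (hL : L.Sizes m κ) (h : ∃ v w, w ∈ L.out v) : 1 ≤ κ := by
  obtain ⟨v, w, hw⟩ := h
  refine le_trans (Finset.card_pos.2 ⟨v, ?_⟩)
    (hL.card_le (fun x => if x = v then some w else none) ?_ ?_)
  · simp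
  · intro x y h
    split_ifs at h with hx
    rwa [hx, ← Option.some.inj h]
  · intro x x' y h h'
    split_ifs at h h' with hx hx'
    rw [hx, hx']

theorem initialMem_isMatch (L : AdjLists n₁ n₂) : IsMatch L L.initialMem := by
  refine ⟨fun _ => rfl, fun _ => rfl, fun v w => ?_, fun _ => rfl, fun v w h => ?_⟩
  · simp [par, rt, AdjLists.initialMem]
  · simp [par, AdjLists.initialMem] at h

/-- The indicator of the roots is a lower bound with `k = 1`, because after the greedy phase free
nodes of `V₁` have only matched neighbours. -/
theorem GreedyDone.stageStart {s : Mem n₁ n₂} {c : List (Fin n₁)}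
    (h : GreedyDone L (List.finRange n₁) L.initialMem c s) : StageStart L 1 c s := by
  have hb : ∀ v w, w ∈ L.out v → par s v = none → rt s w ≠ none := fun v w hw hv =>
    h.blocked v (List.mem_finRange v) hv w hw
  refine ⟨h.isMatch, h.nodup, fun v hv => ((h.mem_iff v).1 hv).2, h.ptrOK, fun v w hw hr => ?_,
    fun w => ?_, fun v => ?_, fun w => ?_, fun w => if rt s w = none then 0 else 1, ?_, ?_, ?_⟩
  · exact (h.mem_iff v).2 ⟨List.mem_finRange v, fun hv => hb v w hw hv hr⟩
  · rw [h.lab_eq]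
    exact Nat.one_pos
  · rw [h.vis₁_eq]
    exact Nat.one_pos
  · rw [h.vis₂_eq]
    exact Nat.one_pos
  · intro w hw
    simp [hw]
  · intro v x w _ _
    split_ifs <;> omega
  · intro v w hv hw
    simp [hb v w hw hv]

theorem algorithm_spec (hL : L.Sizes m κ) :
    Ensures (algorithm n₁ n₂) L.initialMem fun _ s n => IsMatch L s ∧ κ ≤ msize s ∧
      n ≤ 13 * (min (n₁ * κ) m + n₁) + 1 +
        400 * (min (κ ^ 2) m + 1) * (Nat.sqrt κ + 1) := by
  unfold algorithm
  rw [ensures_bind]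
  refine (greedy_spec hL (initialMem_isMatch L) (List.nodup_finRange n₁) fun _ _ => rfl).mono
    fun c s n => ?_
  rintro ⟨h, hn⟩
  refine (stages_spec hL (Nat.lt_succ_sqrt κ) h.stageStart (Nat.le_add_right _ _)).mono
    fun _ s' n' => ?_
  rintro ⟨h1, h2, h3⟩
  refine ⟨h1, h2, ?_⟩
  have h4 : ((List.finRange n₁).map (scanBound L κ)).sum ≤ min (n₁ * κ) m + n₁ := by
    have := sum_scanBound_le hL Finset.univ
    rw [Finset.card_univ, Fintype.card_fin, min_comm] at this
    rwa [← List.sum_toFinset _ (List.nodup_finRange n₁), List.toFinset_finRange]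
  -- With `r = Nat.sqrt κ + 1`, the potential at `t = 1` is at most `(r - 1) + r`.
  have h5 : stagePotential κ (Nat.sqrt κ).succ 1 (msize s) + 1 ≤ 2 * (Nat.sqrt κ + 1) := by
    unfold stagePotential
    omega
  have h6 := Nat.mul_le_mul_left (200 * (min (κ ^ 2) m + 1)) h5
  have h7 : 200 * (min (κ ^ 2) m + 1) * (2 * (Nat.sqrt κ + 1)) =
    400 * (min (κ ^ 2) m + 1) * (Nat.sqrt κ + 1) := by ring
  omega

/-- For `κ ≥ 1` both additive ones are absorbed at the price of a factor `2` each, whence `1600 =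
400 * 4`. -/
theorem time_bound {n a b N : ℕ} (hκ : 1 ≤ κ) (hN : κ ≤ N)
    (h : n ≤ 13 * (a + b) + 1 + 400 * (N + 1) * (Nat.sqrt κ + 1)) :
    (n : ℝ) ≤ 13 * (a + b) + 1 + 1600 * (Real.sqrt κ * N) := by
  have h1 : (Nat.sqrt κ : ℝ) + 1 ≤ 2 * Real.sqrt κ := by
    have h2 : (Nat.sqrt κ : ℝ) ≤ Real.sqrt κ := Real.nat_sqrt_le_real_sqrt
    have h3 : (1 : ℝ) ≤ Real.sqrt κ := Real.one_le_sqrt.2 (by exact_mod_cast hκ)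
    linarith
  have h2 : (N : ℝ) + 1 ≤ 2 * N := by
    have : (1 : ℝ) ≤ N := by exact_mod_cast hκ.trans hN
    linarith
  have h3 : ((N : ℝ) + 1) * (Nat.sqrt κ + 1) ≤ 2 * N * (2 * Real.sqrt κ) :=
    mul_le_mul h2 h1 (by positivity) (by positivity)
  have h4 : (n : ℝ) ≤ 13 * (a + b) + 1 + 400 * (N + 1) * (Nat.sqrt κ + 1) := by exact_mod_cast h
  linarith

end Main

end MatchingPseudoflow

open MatchingPseudoflow in
theorem mainTheorem1 :
    ∃ C : ℝ, ∀ (n₁ n₂ : ℕ) (G : SimpleGraph (Fin n₁ ⊕ Fin n₂))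
      (L : MatchingPseudoflow.AdjLists n₁ n₂) (m κ : ℕ),
      G.IsBipartiteWith (Set.range Sum.inl) (Set.range Sum.inr) →
      L.Represents G →
      m = G.edgeSet.ncard →
      κ = MatchingPseudoflow.matchingNumber G →
      -- the edges in the final `WT₂` branches are the edges of a maximum matching
      (∃ M : G.Subgraph, M.IsMatching ∧ M.edgeSet.ncard = κ ∧
        ∀ (v : Fin n₁) (w : Fin n₂), M.Adj (Sum.inl v) (Sum.inr w) ↔
          MatchingPseudoflow.IsWT₂
            ((MatchingPseudoflow.algorithm n₁ n₂).finalMem L.initialMem) v w) ∧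
      -- the running time
      (1 ≤ n₁ → n₁ ≤ m →
        ((MatchingPseudoflow.algorithm n₁ n₂).time L.initialMem : ℝ) ≤
          C * ((min (n₁ * κ) m : ℕ) + Real.sqrt κ * (min (κ ^ 2) m : ℕ))) ∧
      -- the running time without any condition on `n₁` and `m`
      ((MatchingPseudoflow.algorithm n₁ n₂).time L.initialMem : ℝ) ≤
          C * ((min (n₁ * κ) m : ℕ) + Real.sqrt κ * (min (κ ^ 2) m : ℕ) + n₁ + 1) := by
  refine ⟨2000, fun n₁ n₂ G L m κ hG hL hm hκ => ?_⟩
  have hS := hL.sizes hG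
  rw [← hm, ← hκ] at hS
  obtain ⟨h1, h2, h3⟩ := algorithm_spec hS
  change (algorithm n₁ n₂).time L.initialMem ≤ _ at h3
  change IsMatch L ((algorithm n₁ n₂).finalMem L.initialMem) at h1
  change κ ≤ msize ((algorithm n₁ n₂).finalMem L.initialMem) at h2
  generalize (algorithm n₁ n₂).finalMem L.initialMem = s at h1 h2
  generalize (algorithm n₁ n₂).time L.initialMem = n at h3
  have hκN := kappa_le_min hS
  refine ⟨⟨partnerSubgraph G (par s) fun v w h => (hL.mem_out v w).1 (h1.edge v w h), ?_, ?_, ?_⟩,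
    fun hn₁ hnm => ?_, ?_⟩
  · refine partnerSubgraph_isMatching fun v v' w hv hv' => ?_
    rw [h1.par_iff] at hv hv'
    exact Option.some.inj (hv.symm.trans hv')
  · refine le_antisymm ?_ (h2.trans card_le_ncard_partnerSubgraph)
    rw [hκ]
    refine ncard_le_matchingNumber G _ (partnerSubgraph_isMatching fun v v' w hv hv' => ?_)
    rw [h1.par_iff] at hv hv'
    exact Option.some.inj (hv.symm.trans hv')
  · intro v w
    rw [partnerSubgraph_adj]
    exact ⟨fun h => ⟨h, (h1.par_iff v w).1 h, h1.left w⟩, fun h => h.1⟩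
  -- From `1 ≤ n₁ ≤ m` there is an edge, so `κ ≥ 1`. Then `n₁ ≤ min (n₁ * κ) m`, and the terms `n₁`
  -- and `1` are absorbed.
  · have hpos : 1 ≤ κ := by
      obtain ⟨e, he⟩ := Set.nonempty_of_ncard_ne_zero (s := G.edgeSet) (by omega)
      exact hS.one_le_kappa (hL.exists_mem_out hG he)
    have h4 := time_bound hpos hκN h3
    have h5 : (n₁ : ℝ) ≤ (min (n₁ * κ) m : ℕ) := by
      exact_mod_cast le_min (Nat.le_mul_of_pos_right _ hpos) hnm
    have h6 : (1 : ℝ) ≤ n₁ := by exact_mod_cast hn₁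
    have h7 : 0 ≤ Real.sqrt κ * (min (κ ^ 2) m : ℕ) := by positivity
    linarith
  · have h7 : 0 ≤ Real.sqrt κ * (min (κ ^ 2) m : ℕ) := by positivity
    have h8 : (0 : ℝ) ≤ (min (n₁ * κ) m : ℕ) := by positivity
    have h9 : (0 : ℝ) ≤ n₁ := by positivity
    -- For `κ = 0` both minima vanish and only the added terms `n₁ + 1` can pay.
    rcases Nat.eq_zero_or_pos κ with rfl | hpos
    · have h4 : n ≤ 13 * n₁ + 401 := by simpa using h3
      have h5 : (n : ℝ) ≤ 13 * n₁ + 401 := by exact_mod_cast h4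
      linarith
    · have h4 := time_bound hpos hκN h3
      linarith
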